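/- Let $\rho:\mathfrak g\to\mathrm{gl}(V)$ be a finite-dimensional representation of a finite-dimensional complex Lie algebra $\mathfrak g$. For $x\in V$ let $R_x:\mathfrak g\to V$, $R_x(\xi)=\rho(\xi)x$, and let $\mathrm{St}_x=\mathrm{Ker}\,R_x$ be the stabiliser of $x$. A point $x$ is called regular if $\dim \mathrm{St}_x$ is minimal among all points of $V$, and $r=\max_{y\in V}\mathrm{rk}\,R_y$. For $x,a\in V$ consider the pencil $R_x+\lambda R_a=R_{x+\lambda a}$. Its Jordan--Kronecker canonical form is a block-diagonal sum of Jordan blocks (with finite or infinite eigenvalues), horizontal Kronecker blocks of size $\varepsilon\times(\varepsilon+1)$ and vertical Kronecker blocks of size $(\eta+1)\times\eta$, where $\varepsilon,\eta\ge 0$ (a zero block of size $g\times h$ counts as $g$ vertical blocks of size $1\times 0$ and $h$ horizontal blocks of size $0\times 1$). Let $\mathsf k_{\mathrm{hor}}(x,a)$ be the total number of columns in the horizontal Kronecker blocks, that is, $\sum_i(\varepsilon_i+1)$. The algebraic type of the pencil consists of the number of distinct eigenvalues of its Jordan blocks, the number and sizes of the Jordan blocks for each eigenvalue, and the numbers $\varepsilon_i$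 and $\eta_j$. A pair $(x,a)$ is called generic if it lies in a non-empty Zariski open subset of $V\times V$ on which the algebraic type of the pencil $R_x+\lambda R_a$ is constant. Let $\mathsf k_{\mathrm{hor}}(\rho)$ be the generic value of $\mathsf k_{\mathrm{hor}}(x,a)$, i.e. the value which it takes at all pairs of some non-empty Zariski open subset of $V\times V$. Fix bases of $\mathfrak g$ and $V$, and let $p_1,\dots,p_N$ be the $r\times r$ minors of the matrix of $R_y$ that do not vanish identically, regarded as polynomials in $y\in V$. Let $\mathsf p_\rho$ be their greatest common divisor, write $p_i=\mathsf p_\rho h_i$, and put $\mathsf{Sing}_1=\{y\in V : h_1(y)=\dots=h_N(y)=0\}$. Let $x\in V$ be regular and let $a\in V$. Then $$\dim \sum_{\lambda}\mathrm{St}_{x+\lambda a}=\mathsf k_{\mathrm{hor}}(x,a),$$ where the sum is over all $\lambda\in\mathbb C$ for which $x+\lambda a$ is regular. If, moreover, $a+\lambda x\notin\mathsf{Sing}_1$ for all $\lambda\in\mathbb C$, then $$\dim \sum_{\lambda}\mathrm{St}_{x+\lambda a}=\mathsf k_{\mathrm{hor}}(\rho).$$ In particular, if $(x,a)$ is generic,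 then $a+\lambda x\notin\mathsf{Sing}_1$ for all $\lambda\in\mathbb C$, and the last equality holds. -/

import Mathlib

/-! The space of endomorphisms `Module.End ℂ V` is the Lie algebra `gl(V)`, with the commutator as
bracket. -/
attribute [local instance] LieRing.ofAssociativeRing

noncomputable section

namespace JK

/-! ### Kronecker canonical form of a pencil of linear operators -/

/-- The types of blocks of the Jordan-Kronecker canonical form of a complex pencil `A + t B`:
* `jordan μ n`: a Jordan block of size `n + 1` with eigenvalue `μ` (a number or infinity);
* `hor ε`: the horizontal Kronecker block of size `ε × (ε + 1)`;
* `vert η`: the vertical Kronecker block of size `(η + 1) × η`.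
A zero block of size `g × h` is regarded as the sum of `g` copies of `vert 0` and
`h` copies of `hor 0`. -/
inductive Block where
  | jordan (μ : OnePoint ℂ) (n : ℕ)
  | hor (ε : ℕ)
  | vert (η : ℕ)

namespace Block

/-- The number of rows of a block. -/
def rows : Block → ℕ
  | jordan _ n => n + 1
  | hor ε => ε
  | vert η => η + 1

/-- The number of columns of a block. -/
def cols : Block → ℕ
  | jordan _ n => n + 1
  | hor ε => ε + 1
  | vert η => η

/-- The entries of the first matrix `A` of a block (rows and columns are numbered from `0`). -/
def entryA : Block → ℕ → ℕ → ℂ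
  | jordan (OnePoint.some z) _, i, j => if i = j then z else if i + 1 = j then 1 else 0
  | jordan OnePoint.infty _, i, j => if i = j then 1 else 0
  | hor _, i, j => if i = j then 1 else 0
  | vert _, i, j => if i = j then 1 else 0

/-- The entries of the second matrix `B` of a block (rows and columns are numbered from `0`). -/
def entryB : Block → ℕ → ℕ → ℂ
  | jordan (OnePoint.some _) _, i, j => if i = j then 1 else 0
  | jordan OnePoint.infty _, i, j => if i + 1 = j then 1 else 0
  | hor _, i, j => if i + 1 = j then 1 else 0
  | vert _, i, j => if i = j + 1 then 1 else 0

/-- The first matrix of a block. -/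
def matA (b : Block) : Matrix (Fin b.rows) (Fin b.cols) ℂ :=
  Matrix.of fun i j => b.entryA i j

/-- The second matrix of a block. -/
def matB (b : Block) : Matrix (Fin b.rows) (Fin b.cols) ℂ :=
  Matrix.of fun i j => b.entryB i j

/-- The contribution of a block to the total Kronecker `h`-index: the number of columns of a
horizontal Kronecker block, and `0` for the other blocks. -/
def horCols : Block → ℕ
  | hor ε => ε + 1
  | _ => 0

/-- Rename the eigenvalue of a Jordan block; Kronecker blocks are unchanged. -/
def relabel (σ : Equiv.Perm (OnePoint ℂ)) : Block → Block
  | jordan μ n => jordan (σ μ) n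
  | hor ε => hor ε
  | vert η => vert η

end Block

section Pencils

variable {U W U' W' : Type*} [AddCommGroup U] [Module ℂ U] [AddCommGroup W] [Module ℂ W]
  [AddCommGroup U'] [Module ℂ U'] [AddCommGroup W'] [Module ℂ W']

/-- In suitable bases of `U` and `W` the operators `A, B : U → W` are simultaneously
block-diagonal with the canonical blocks `b 0, …, b (N - 1)`. -/
def HasCanonicalForm (A B : U →ₗ[ℂ] W) {N : ℕ} (b : Fin N → Block) : Prop :=
  ∃ (u : Module.Basis (Σ i, Fin (b i).cols) ℂ U) (w : Module.Basis (Σ i, Fin (b i).rows) ℂ W),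
    LinearMap.toMatrix u w A = Matrix.blockDiagonal' (fun i => (b i).matA) ∧
    LinearMap.toMatrix u w B = Matrix.blockDiagonal' (fun i => (b i).matB)

/-- The total Kronecker `h`-index of the pencil `A + t B`: the total number of columns in the
horizontal Kronecker blocks of its canonical form. (The canonical form exists and is unique up to
the order of the blocks, so the set has exactly one element.) -/
def kHorPencil (A B : U →ₗ[ℂ] W) : ℕ :=
  sInf {k | ∃ (N : ℕ) (b : Fin N → Block), HasCanonicalForm A B b ∧ ∑ i, (b i).horCols = k}

/-- Two pencils have the same algebraic type: the same minimal row and column indices, the same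
number of distinct eigenvalues, and the same numbers and sizes of Jordan blocks at corresponding
eigenvalues. Equivalently, their canonical forms agree after renaming the eigenvalues. -/
def SameAlgebraicType (A B : U →ₗ[ℂ] W) (A' B' : U' →ₗ[ℂ] W') : Prop :=
  ∃ (N : ℕ) (b : Fin N → Block) (σ : Equiv.Perm (OnePoint ℂ)),
    HasCanonicalForm A B b ∧ HasCanonicalForm A' B' (fun i => (b i).relabel σ)

end Pencils

/-- Zariski open subsets of a finite-dimensional complex vector space `E`: unions of
non-vanishing sets of polynomial functions, i.e. of polynomials in linear functionals on `E`. -/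
def IsZariskiOpen {E : Type*} [AddCommGroup E] [Module ℂ E] (W : Set E) : Prop :=
  ∃ S : Set (MvPolynomial (Module.Dual ℂ E) ℂ),
    W = {y | ∃ q ∈ S, MvPolynomial.eval (fun φ : Module.Dual ℂ E => φ y) q ≠ 0}

/-! ### Representations -/

section Representations

variable {𝔤 V : Type*} [LieRing 𝔤] [LieAlgebra ℂ 𝔤] [AddCommGroup V] [Module ℂ V]

/-- The operator `R_x : 𝔤 → V`, `R_x ξ = ρ(ξ) x`. -/
def R (ρ : 𝔤 →ₗ⁅ℂ⁆ Module.End ℂ V) (x : V) : 𝔤 →ₗ[ℂ] V :=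
  LinearMap.applyₗ x ∘ₗ (ρ : 𝔤 →ₗ[ℂ] Module.End ℂ V)

/-- The stabiliser `St_x = {ξ | ρ(ξ) x = 0}`, as a subspace of `𝔤`. -/
def stabiliser (ρ : 𝔤 →ₗ⁅ℂ⁆ Module.End ℂ V) (x : V) : Submodule ℂ 𝔤 :=
  LinearMap.ker (R ρ x)

/-- A point is regular if its stabiliser has the minimal possible dimension. -/
def IsRegular (ρ : 𝔤 →ₗ⁅ℂ⁆ Module.End ℂ V) (a : V) : Prop :=
  ∀ x : V, Module.finrank ℂ (stabiliser ρ a) ≤ Module.finrank ℂ (stabiliser ρ x)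

/-- The sum of the stabilisers `St_{x + t a}` over all `t ∈ ℂ` for which `x + t a` is regular. -/
def stabiliserSum (ρ : 𝔤 →ₗ⁅ℂ⁆ Module.End ℂ V) (x a : V) : Submodule ℂ 𝔤 :=
  ⨆ t ∈ {t : ℂ | IsRegular ρ (x + t • a)}, stabiliser ρ (x + t • a)

/-- `k_hor(x, a)`: the total Kronecker `h`-index of the pencil `R_x + t R_a = R_{x + t a}`. -/
def kHor (ρ : 𝔤 →ₗ⁅ℂ⁆ Module.End ℂ V) (x a : V) : ℕ :=
  kHorPencil (R ρ x) (R ρ a)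

/-- A pair `(x, a)` is generic if it lies in a (non-empty) Zariski open subset of `V × V` on which
the algebraic type of the pencil `R_x + t R_a` is one and the same. -/
def IsGenericPair (ρ : 𝔤 →ₗ⁅ℂ⁆ Module.End ℂ V) (x a : V) : Prop :=
  ∃ W : Set (V × V), IsZariskiOpen W ∧ (x, a) ∈ W ∧
    ∀ y c : V, (y, c) ∈ W → SameAlgebraicType (R ρ x) (R ρ a) (R ρ y) (R ρ c)

/-- `k_hor(ρ)`: the generic value of `k_hor(x, a)`, i.e. the value which it takes at all pairs of
a non-empty Zariski open subset of `V × V`. (The set has exactly one element, because `k_hor` is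
generically constant and two non-empty Zariski open sets meet.) -/
def kHorRep (ρ : 𝔤 →ₗ⁅ℂ⁆ Module.End ℂ V) : ℕ :=
  sInf {k | ∃ W : Set (V × V), IsZariskiOpen W ∧ W.Nonempty ∧
    ∀ x a : V, (x, a) ∈ W → kHor ρ x a = k}

/-- `r = max_x rk R_x`, the dimension of a regular orbit. -/
def regRank (ρ : 𝔤 →ₗ⁅ℂ⁆ Module.End ℂ V) : ℕ :=
  ⨆ x : V, Module.finrank ℂ (LinearMap.range (R ρ x))

section Minors

variable {m n : ℕ} (ρ : 𝔤 →ₗ⁅ℂ⁆ Module.End ℂ V)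
  (e : Module.Basis (Fin m) ℂ 𝔤) (f : Module.Basis (Fin n) ℂ V)

/-- The matrix of `R_x` in the bases `e` of `𝔤` and `f` of `V`; its entries are linear forms in
the coordinates `X 0, …, X (n - 1)` of `x` in the basis `f`. -/
def polyMatrix : Matrix (Fin n) (Fin m) (MvPolynomial (Fin n) ℂ) :=
  Matrix.of fun i j => ∑ k, MvPolynomial.C (f.repr (ρ (e j) (f k)) i) * MvPolynomial.X k

/-- The `r × r` minors of the matrix of `R_x`, as polynomials on `V`. -/
def minor (s : Fin (regRank ρ) ↪o Fin n) (t : Fin (regRank ρ) ↪o Fin m) :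
    MvPolynomial (Fin n) ℂ :=
  ((polyMatrix ρ e f).submatrix s t).det

/-- `p` is the fundamental semi-invariant of `ρ`: a greatest common divisor of the `r × r` minors
(it is unique up to a non-zero constant factor). -/
def IsFundamentalSemiInvariant (p : MvPolynomial (Fin n) ℂ) : Prop :=
  (∀ s t, p ∣ minor ρ e f s t) ∧
    ∀ d : MvPolynomial (Fin n) ℂ, (∀ s t, d ∣ minor ρ e f s t) → d ∣ p

/-- `Sing₁`: the common zero set of the polynomials `h` obtained from the `r × r` minors
that do not vanish identically by dividing them by the fundamental semi-invariant. -/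
def Sing₁ : Set V :=
  {x | ∃ p, IsFundamentalSemiInvariant ρ e f p ∧
    ∀ s t, minor ρ e f s t ≠ 0 →
      ∀ h, minor ρ e f s t = p * h → MvPolynomial.eval (fun i => f.repr x i) h = 0}

end Minors

end Representations

end JK

end

/-! Everything is read off the Kronecker form of the pencil A + tB with A = R_x, B = R_a, whose
existence is proved here by splitting off one block at a time.

First equality. At a parameter t that is not an eigenvalue, the kernel of A + tB is spanned by one
vector from each horizontal block of size ε × (ε + 1), with coordinates (-t)^(ε - j). These are
points of a rational normal curve, so infinitely many of them span all the columns of the block. If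
x is regular, then x + ta is regular for all but finitely many t, and never when -t is an
eigenvalue; hence the sum of the stabilisers is the span of the columns of the horizontal blocks
(`RegularPoint.finrank_kerSum`).

Second equality. Let k_vert be the number of rows in the vertical blocks and J the total size of the
Jordan blocks. Counting rows gives k_hor + k_vert + J = dim V + dim St_x for regular x
(`RegularPoint.finrank_kerSum_add`). Both k_hor and, through the transposed pencil, k_vert are
dimensions of sums of kernels at regular points. Such dimensions are lower semicontinuous, so
neither exceeds its generic value (`exists_generic_kerSum`). Therefore, if J is as small as
possible, both attain their generic values (`IsRegular.kHor_eq_kHorRep_of_sum_jordanSize_le`).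

It remains to minimise J. The r × r minors of R_a + X R_x generate an ideal of ℂ[X] whose generator
is the product of the determinants of the Jordan blocks; it has degree J because regularity of x
excludes the eigenvalue 0. On the other hand these minors are the p_i restricted to the line a + Xx,
that is, p times h_i restricted, and the restriction of p keeps its degree, again because x is
regular. Hence J ≥ deg p, with equality exactly when the h_i have no common zero on the line
(`IsRegular.totalDegree_le_sum_jordanSize`).

Generic pairs. The h_i are coprime, so a generic line in the direction x misses their common zeros
(`exists_generic_line`). Inside the open set of constant type one can keep x and move a to such a
line. There J = deg p, and J depends only on the type, so J = deg p for the original pair, whose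
line then misses `Sing₁` as well. -/

namespace JK

/-! ### Chains of a pencil -/

section Chains

variable {U W : Type*} [AddCommGroup U] [Module ℂ U] [AddCommGroup W] [Module ℂ W]

/-- The vectors `u` which start a sequence `u = v 0, v 1, …, v k` with `P (v (i + 1)) = Q (v i)`
and `v k ∈ F`. -/
def chainSpace (P Q : U →ₗ[ℂ] W) (F : Submodule ℂ U) : ℕ → Submodule ℂ U
  | 0 => F
  | k + 1 => ((chainSpace P Q F k).map P).comap Q

theorem exists_chain {P Q : U →ₗ[ℂ] W} {F : Submodule ℂ U} {k : ℕ} {u : U}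
    (hu : u ∈ chainSpace P Q F k) :
    ∃ v : ℕ → U, v 0 = u ∧ (∀ i < k, P (v (i + 1)) = Q (v i)) ∧ v k ∈ F := by
  induction k generalizing u with
  | zero => exact ⟨fun _ => u, rfl, by simp, hu⟩
  | succ k ih =>
    obtain ⟨u', hu', hP⟩ := hu
    obtain ⟨v, hv0, hv, hvk⟩ := ih hu'
    refine ⟨fun i => Nat.casesOn i u v, rfl, ?_, hvk⟩
    rintro (_ | i) hi
    · simpa [hv0] using hP
    · exact hv i (by omega)

theorem exists_dual_comp_eq {Y Z : Type*} [AddCommGroup Y] [Module ℂ Y] [AddCommGroup Z]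
    [Module ℂ Z] (f : Y →ₗ[ℂ] Z) (φ : Module.Dual ℂ Y) (h : LinearMap.ker f ≤ LinearMap.ker φ) :
    ∃ ψ : Module.Dual ℂ Z, ψ ∘ₗ f = φ := by
  have : φ ∈ LinearMap.range f.dualMap := by
    rw [LinearMap.range_dualMap_eq_dualAnnihilator_ker, Submodule.mem_dualAnnihilator]
    exact fun w hw => h hw
  obtain ⟨ψ, hψ⟩ := this
  exact ⟨ψ, hψ⟩

/-- The kernel of U → W/E induced by Q is Q⁻¹(E), so y ∘ P factors through this map. -/
theorem exists_dual_shift {P Q : U →ₗ[ℂ] W} {y : Module.Dual ℂ W}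
    {E : Submodule ℂ W} (hy : ∀ u, Q u ∈ E → y (P u) = 0) :
    ∃ y' : Module.Dual ℂ W, (∀ e ∈ E, y' e = 0) ∧ y ∘ₗ P = y' ∘ₗ Q := by
  obtain ⟨ψ, hψ⟩ := exists_dual_comp_eq (E.mkQ ∘ₗ Q) (y ∘ₗ P) (by
    intro u hu
    rw [LinearMap.mem_ker, LinearMap.comp_apply, Submodule.mkQ_apply,
      Submodule.Quotient.mk_eq_zero] at hu
    exact hy u hu)
  refine ⟨ψ ∘ₗ E.mkQ, fun e he => ?_, by rw [← hψ]; rfl⟩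
  simp [(Submodule.Quotient.mk_eq_zero E).2 he]

theorem exists_dual_chain {P Q : U →ₗ[ℂ] W} {F : Submodule ℂ U} {n : ℕ} {y₀ : Module.Dual ℂ W}
    (hy : ∀ u ∈ chainSpace P Q F n, y₀ (P u) = 0) :
    ∃ y : ℕ → Module.Dual ℂ W, y 0 = y₀ ∧ (∀ i < n, y i ∘ₗ P = y (i + 1) ∘ₗ Q) ∧
      ∀ u ∈ F, y n (P u) = 0 := by
  induction n generalizing y₀ with
  | zero => exact ⟨fun _ => y₀, rfl, by simp, hy⟩
  | succ n ih =>
    obtain ⟨y', hy', h⟩ := exists_dual_shift (y := y₀) (P := P) (Q := Q)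
      (E := (chainSpace P Q F n).map P) hy
    obtain ⟨y, h0, h1, h2⟩ := ih (y₀ := y') fun u hu => hy' _ ⟨u, hu, rfl⟩
    refine ⟨fun i => Nat.casesOn i y₀ y, rfl, ?_, h2⟩
    rintro (_ | i) hi
    · simpa [h0] using h
    · exact h1 i (by omega)

/-- A vector outside the `n`-th chain space is detected by a chain of functionals. -/
theorem exists_dual_chain_of_notMem {P Q : U →ₗ[ℂ] W} {F : Submodule ℂ U} {n : ℕ} {c : U}
    (hc : c ∉ chainSpace P Q F (n + 1)) :
    ∃ y : ℕ → Module.Dual ℂ W, y 0 (Q c) ≠ 0 ∧ (∀ i < n, y i ∘ₗ P = y (i + 1) ∘ₗ Q) ∧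
      ∀ u ∈ F, y n (P u) = 0 := by
  obtain ⟨y₀, h0, h1⟩ := Submodule.exists_le_ker_of_notMem
    (p := (chainSpace P Q F n).map P) (v := Q c) hc
  obtain ⟨y, hy0, hy1, hy2⟩ := exists_dual_chain (P := P) (Q := Q) (F := F) (n := n) (y₀ := y₀)
    fun u hu => h1 ⟨u, hu, rfl⟩
  exact ⟨y, by rwa [hy0], hy1, hy2⟩

/-- One step down in both chains leaves the pairing unchanged: y_(i+1) Q c_(j+1) = y_i P c_(j+1) =
y_i Q c_j. The pairing matrix is therefore upper triangular Toeplitz, which is what makes it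
invertible below. -/
theorem dual_chain_apply {P Q : U →ₗ[ℂ] W} {y : ℕ → Module.Dual ℂ W} {c : ℕ → U} {n N : ℕ}
    (hc0 : P (c 0) = 0) (hc : ∀ j < N, P (c (j + 1)) = Q (c j))
    (hy : ∀ i < n, y i ∘ₗ P = y (i + 1) ∘ₗ Q) {i j : ℕ} (hi : i ≤ n) (hj : j ≤ N) :
    y i (Q (c j)) = if i ≤ j then y 0 (Q (c (j - i))) else 0 := by
  induction i generalizing j with
  | zero => simp
  | succ i ih =>
    have h := LinearMap.congr_fun (hy i (by omega)) (c j)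
    simp only [LinearMap.comp_apply] at h
    rw [← h]
    cases j with
    | zero => simp [hc0]
    | succ j => rw [hc j (by omega), ih (by omega) (by omega)]; simp

/-- There is a non-zero sequence `v 0, …, v k` with `P (v 0) = 0`, `P (v (i + 1)) = Q (v i)` and
`Q (v k) = 0`. -/
def HasTerminatingChain (P Q : U →ₗ[ℂ] W) : Prop :=
  ∃ k, ∃ c ∈ chainSpace P Q (LinearMap.ker Q) k, c ≠ 0 ∧ P c = 0

theorem chainSpace_le_succ {P Q : U →ₗ[ℂ] W} {F : Submodule ℂ U}
    (h : F ≤ chainSpace P Q F 1) (k : ℕ) : chainSpace P Q F k ≤ chainSpace P Q F (k + 1) := by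
  induction k with
  | zero => exact h
  | succ k ih => exact Submodule.comap_mono (Submodule.map_mono ih)

theorem chainSpace_succ_le {P Q : U →ₗ[ℂ] W} {F : Submodule ℂ U}
    (h : chainSpace P Q F 1 ≤ F) (k : ℕ) : chainSpace P Q F (k + 1) ≤ chainSpace P Q F k := by
  induction k with
  | zero => exact h
  | succ k ih => exact Submodule.comap_mono (Submodule.map_mono ih)

/-- The spaces of starting points of chains ending in ker Q increase to some F with F = Q⁻¹(P F). If
no chain terminates, P is injective on F, so dim P F = dim F; since Q embeds U/F into W/P F, this
forces dim U ≤ dim W. -/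
theorem hasTerminatingChain_of_finrank_lt [FiniteDimensional ℂ U] [FiniteDimensional ℂ W]
    (P Q : U →ₗ[ℂ] W) (h : Module.finrank ℂ W < Module.finrank ℂ U) :
    HasTerminatingChain P Q := by
  by_contra hno
  have hmono : Monotone (chainSpace P Q (LinearMap.ker Q)) :=
    monotone_nat_of_le_succ (chainSpace_le_succ fun u hu => by
      change Q u ∈ (LinearMap.ker Q).map P
      rw [LinearMap.mem_ker.1 hu]; exact zero_mem _)
  obtain ⟨k, hk⟩ := monotone_stabilizes_iff_noetherian.2
    (inferInstance : IsNoetherian ℂ U) ⟨_, hmono⟩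
  have hk : chainSpace P Q (LinearMap.ker Q) k = chainSpace P Q (LinearMap.ker Q) (k + 1) :=
    hk (k + 1) (by omega)
  set F := chainSpace P Q (LinearMap.ker Q) k with hF
  have hF' : F = (F.map P).comap Q := hk
  have hinj : Function.Injective (P.domRestrict F) := by
    rw [← LinearMap.ker_eq_bot, Submodule.eq_bot_iff]
    rintro ⟨u, hu⟩ hPu
    by_contra hne
    exact hno ⟨k, u, hu, by simpa using hne, by simpa using hPu⟩
  have h1 : Module.finrank ℂ (F.map P) = Module.finrank ℂ F := by
    rw [← LinearMap.range_domRestrict]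
    exact LinearMap.finrank_range_of_inj hinj
  have h2 := LinearMap.finrank_range_add_finrank_ker ((F.map P).mkQ ∘ₗ Q)
  have h3 : LinearMap.ker ((F.map P).mkQ ∘ₗ Q) = F := by
    rw [LinearMap.ker_comp, Submodule.ker_mkQ, ← hF']
  have h4 := Submodule.finrank_le (LinearMap.range ((F.map P).mkQ ∘ₗ Q))
  have h5 := Submodule.finrank_quotient_add_finrank (F.map P)
  rw [h3] at h2
  omega

/-- If no chain terminates, then the length of chains is bounded. -/
theorem exists_chainSpace_top_disjoint [FiniteDimensional ℂ U] [FiniteDimensional ℂ W]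
    {P Q : U →ₗ[ℂ] W} (hno : ¬ HasTerminatingChain P Q) :
    ∃ k, ∀ c ∈ chainSpace P Q ⊤ k, P c = 0 → c = 0 := by
  have hanti : Antitone (chainSpace P Q ⊤) := antitone_nat_of_succ_le (chainSpace_succ_le le_top)
  obtain ⟨k, hk⟩ := monotone_stabilizes_iff_artinian.2
    (inferInstance : IsArtinian ℂ U) ⟨fun k => OrderDual.toDual (chainSpace P Q ⊤ k), hanti⟩
  have hk : chainSpace P Q ⊤ k = chainSpace P Q ⊤ (k + 1) := hk (k + 1) (by omega)
  refine ⟨k, ?_⟩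
  set F := chainSpace P Q ⊤ k with hF
  have hF' : F = (F.map P).comap Q := hk
  -- A non-zero vector of ker P in the stable space F = Q⁻¹(P F) gives dim P F < dim F. The pencil
  -- restricted to F → P F then has a terminating chain, which is also one for the original pencil.
  by_contra! hc
  obtain ⟨c, hcF, hPc, hc0⟩ := hc
  let P' : F →ₗ[ℂ] F.map P := P.restrict fun u hu => ⟨u, hu, rfl⟩
  let Q' : F →ₗ[ℂ] F.map P := Q.restrict fun u hu => by rw [hF'] at hu; exact hu
  have hlt : Module.finrank ℂ (F.map P) < Module.finrank ℂ F := by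
    have h1 := LinearMap.finrank_range_add_finrank_ker (P.domRestrict F)
    rw [LinearMap.range_domRestrict] at h1
    have h2 : 0 < Module.finrank ℂ (LinearMap.ker (P.domRestrict F)) := by
      rw [Module.finrank_pos_iff_exists_ne_zero]
      exact ⟨⟨⟨c, hcF⟩, by simpa using hPc⟩, by simpa [Subtype.ext_iff] using hc0⟩
    omega
  have key : ∀ j (u : F), u ∈ chainSpace P' Q' (LinearMap.ker Q') j →
      (u : U) ∈ chainSpace P Q (LinearMap.ker Q) j := by
    intro j
    induction j with
    | zero =>
      intro u hu
      exact LinearMap.mem_ker.2 (congrArg Subtype.val (LinearMap.mem_ker.1 hu))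
    | succ j ih =>
      rintro u ⟨v, hv, hvu⟩
      exact ⟨v, ih v hv, congrArg Subtype.val hvu⟩
  obtain ⟨j, u, hu, hu0, hPu⟩ := hasTerminatingChain_of_finrank_lt P' Q' hlt
  exact hno ⟨j, u, key j u hu, by simpa using hu0, congrArg Subtype.val hPu⟩

end Chains

/-! ### Block forms -/

namespace Block

/-- The type of the block of the transposed pencil. -/
def dual : Block → Block
  | jordan μ n => jordan μ n
  | hor ε => vert ε
  | vert η => hor η

/-- The rows of a block are the columns of the dual block. -/
def rowsEquiv : (b : Block) → Fin b.rows ≃ Fin b.dual.cols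
  | jordan _ _ => Fin.revPerm
  | hor _ => Equiv.refl _
  | vert _ => Equiv.refl _

/-- The columns of a block are the rows of the dual block. -/
def colsEquiv : (b : Block) → Fin b.cols ≃ Fin b.dual.rows
  | jordan _ _ => Fin.revPerm
  | hor _ => Equiv.refl _
  | vert _ => Equiv.refl _

theorem rev_eq_rev_iff {n : ℕ} (j k : Fin (n + 1)) :
    (Fin.rev j : ℕ) = Fin.rev k ↔ (k : ℕ) = j := by
  rw [Fin.val_rev, Fin.val_rev]; omega

theorem rev_succ_eq_rev_iff {n : ℕ} (j k : Fin (n + 1)) :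
    (Fin.rev j : ℕ) + 1 = Fin.rev k ↔ (k : ℕ) + 1 = j := by
  rw [Fin.val_rev, Fin.val_rev]; omega

/-- Transposition moves the ones of a Jordan block below the diagonal; reversing the numbering of
rows and columns moves them back, so Jordan blocks are self-dual. -/
theorem matA_dual (b : Block) (k : Fin b.rows) (j : Fin b.cols) :
    b.dual.matA (b.colsEquiv j) (b.rowsEquiv k) = b.matA k j := by
  rcases b with ⟨_ | z, n⟩ | ε | η
  · exact if_congr (rev_eq_rev_iff j k) rfl rfl
  · exact if_congr (rev_eq_rev_iff j k) rfl (if_congr (rev_succ_eq_rev_iff j k) rfl rfl)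
  · exact if_congr eq_comm rfl rfl
  · exact if_congr eq_comm rfl rfl

theorem matB_dual (b : Block) (k : Fin b.rows) (j : Fin b.cols) :
    b.dual.matB (b.colsEquiv j) (b.rowsEquiv k) = b.matB k j := by
  rcases b with ⟨_ | z, n⟩ | ε | η
  · exact if_congr (rev_succ_eq_rev_iff j k) rfl rfl
  · exact if_congr (rev_eq_rev_iff j k) rfl rfl
  · exact if_congr eq_comm rfl rfl
  · exact if_congr eq_comm rfl rfl

end Block

section BlockForm

variable {U W U' W' : Type*} [AddCommGroup U] [Module ℂ U] [AddCommGroup W] [Module ℂ W]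
  [AddCommGroup U'] [Module ℂ U'] [AddCommGroup W'] [Module ℂ W']

/-- A version of `HasCanonicalForm` for blocks indexed by an arbitrary type. -/
def HasBlockForm {ι : Type} (A B : U →ₗ[ℂ] W) (b : ι → Block) : Prop :=
  ∃ (u : Module.Basis (Σ i, Fin (b i).cols) ℂ U) (w : Module.Basis (Σ i, Fin (b i).rows) ℂ W),
    (∀ i j, A (u ⟨i, j⟩) = ∑ k, (b i).matA k j • w ⟨i, k⟩) ∧
    (∀ i j, B (u ⟨i, j⟩) = ∑ k, (b i).matB k j • w ⟨i, k⟩)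

theorem toMatrix_eq_blockDiagonal'_iff {ι : Type} [Fintype ι] [DecidableEq ι] {α β : ι → Type}
    [∀ i, Fintype (α i)] [∀ i, DecidableEq (α i)] [∀ i, Fintype (β i)] [∀ i, DecidableEq (β i)]
    (u : Module.Basis (Σ i, α i) ℂ U) (w : Module.Basis (Σ i, β i) ℂ W) (A : U →ₗ[ℂ] W)
    (M : ∀ i, Matrix (β i) (α i) ℂ) :
    LinearMap.toMatrix u w A = Matrix.blockDiagonal' M ↔
      ∀ i j, A (u ⟨i, j⟩) = ∑ k, M i k j • w ⟨i, k⟩ := by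
  have h : ∀ i j, ∑ p : Σ i, β i, Matrix.blockDiagonal' M p ⟨i, j⟩ • w p =
      ∑ k, M i k j • w ⟨i, k⟩ := by
    intro i j
    rw [Fintype.sum_sigma, Finset.sum_eq_single i]
    · simp [Matrix.blockDiagonal'_apply_eq]
    · intro i' _ hne
      exact Finset.sum_eq_zero fun k _ => by rw [Matrix.blockDiagonal'_apply_ne _ _ _ hne, zero_smul]
    · simp
  constructor
  · intro hM i j
    have h2 : ∀ p, Matrix.blockDiagonal' M p ⟨i, j⟩ = w.repr (A (u ⟨i, j⟩)) p := fun p => by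
      rw [← hM, LinearMap.toMatrix_apply]
    simp only [← h, h2, Module.Basis.sum_repr]
  · intro hA
    ext p q
    obtain ⟨i, j⟩ := q
    rw [LinearMap.toMatrix_apply, hA, ← h, Module.Basis.repr_sum_self]

theorem hasCanonicalForm_iff {A B : U →ₗ[ℂ] W} {N : ℕ} {b : Fin N → Block} :
    HasCanonicalForm A B b ↔ HasBlockForm A B b := by
  unfold HasCanonicalForm HasBlockForm
  simp only [toMatrix_eq_blockDiagonal'_iff]

theorem HasBlockForm.map {ι : Type} {A B : U →ₗ[ℂ] W} {A' B' : U' →ₗ[ℂ] W'} {b : ι → Block}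
    (h : HasBlockForm A B b) (f : U ≃ₗ[ℂ] U') (g : W ≃ₗ[ℂ] W')
    (hA : ∀ x, A' (f x) = g (A x)) (hB : ∀ x, B' (f x) = g (B x)) : HasBlockForm A' B' b := by
  obtain ⟨u, w, h1, h2⟩ := h
  exact ⟨u.map f, w.map g, fun i j => by simp [hA, h1], fun i j => by simp [hB, h2]⟩

theorem HasBlockForm.reindex {ι κ : Type} {A B : U →ₗ[ℂ] W} {b : ι → Block}
    (h : HasBlockForm A B b) (e : κ ≃ ι) : HasBlockForm A B (b ∘ e) := by
  obtain ⟨u, w, h1, h2⟩ := h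
  refine ⟨u.reindex (Equiv.sigmaCongrLeft (β := fun i => Fin (b i).cols) e).symm,
    w.reindex (Equiv.sigmaCongrLeft (β := fun i => Fin (b i).rows) e).symm,
    fun i j => ?_, fun i j => ?_⟩
  · simpa [Equiv.sigmaCongrLeft] using h1 (e i) j
  · simpa [Equiv.sigmaCongrLeft] using h2 (e i) j

theorem HasBlockForm.exists_hasCanonicalForm {ι : Type} [Finite ι] {A B : U →ₗ[ℂ] W}
    {b : ι → Block} (h : HasBlockForm A B b) :
    ∃ (N : ℕ) (b : Fin N → Block), HasCanonicalForm A B b := by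
  obtain ⟨N, ⟨e⟩⟩ := Finite.exists_equiv_fin ι
  exact ⟨N, b ∘ e.symm, hasCanonicalForm_iff.2 (h.reindex e.symm)⟩

theorem HasBlockForm.prodMap {ι κ : Type} {A B : U →ₗ[ℂ] W} {A' B' : U' →ₗ[ℂ] W'}
    {b : ι → Block} {b' : κ → Block} (h : HasBlockForm A B b) (h' : HasBlockForm A' B' b') :
    HasBlockForm (A.prodMap A') (B.prodMap B') (Sum.elim b b') := by
  obtain ⟨u, w, h1, h2⟩ := h
  obtain ⟨u', w', h1', h2'⟩ := h'
  let eU : (Σ i, Fin (Sum.elim b b' i).cols) ≃ (Σ i, Fin (b i).cols) ⊕ Σ i, Fin (b' i).cols :=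
    Equiv.sumSigmaDistrib _
  let eW : (Σ i, Fin (Sum.elim b b' i).rows) ≃ (Σ i, Fin (b i).rows) ⊕ Σ i, Fin (b' i).rows :=
    Equiv.sumSigmaDistrib _
  refine ⟨(u.prod u').reindex eU.symm, (w.prod w').reindex eW.symm, ?_, ?_⟩
  all_goals
    simp only [Module.Basis.reindex_apply, Equiv.symm_symm]
    rintro (i | i) j
  · change (A.prodMap A') ((u.prod u') (Sum.inl ⟨i, j⟩)) =
      ∑ k, (b i).matA k j • (w.prod w') (Sum.inl ⟨i, k⟩)
    ext <;> simp [Prod.fst_sum, Prod.snd_sum]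
    exact h1 i j
  · change (A.prodMap A') ((u.prod u') (Sum.inr ⟨i, j⟩)) =
      ∑ k, (b' i).matA k j • (w.prod w') (Sum.inr ⟨i, k⟩)
    ext <;> simp [Prod.fst_sum, Prod.snd_sum]
    exact h1' i j
  · change (B.prodMap B') ((u.prod u') (Sum.inl ⟨i, j⟩)) =
      ∑ k, (b i).matB k j • (w.prod w') (Sum.inl ⟨i, k⟩)
    ext <;> simp [Prod.fst_sum, Prod.snd_sum]
    exact h2 i j
  · change (B.prodMap B') ((u.prod u') (Sum.inr ⟨i, j⟩)) =
      ∑ k, (b' i).matB k j • (w.prod w') (Sum.inr ⟨i, k⟩)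
    ext <;> simp [Prod.fst_sum, Prod.snd_sum]
    exact h2' i j

/-- The transposed pencil has the dual canonical form. -/
theorem HasBlockForm.dualMap {ι : Type} [Fintype ι] {A B : U →ₗ[ℂ] W} {b : ι → Block}
    (h : HasBlockForm A B b) : HasBlockForm A.dualMap B.dualMap (fun i => (b i).dual) := by
  classical
  obtain ⟨u, w, h1, h2⟩ := h
  have key : ∀ (C : U →ₗ[ℂ] W) (M : ∀ i, Matrix (Fin (b i).rows) (Fin (b i).cols) ℂ)
      (_ : ∀ i j, C (u ⟨i, j⟩) = ∑ k, M i k j • w ⟨i, k⟩) (i) (k : Fin (b i).rows),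
      C.dualMap (w.dualBasis ⟨i, k⟩) = ∑ j, M i k j • u.dualBasis ⟨i, j⟩ := by
    intro C M hC i k
    refine u.ext fun ⟨i', j'⟩ => ?_
    simp only [LinearMap.dualMap_apply, hC, map_sum, map_smul, LinearMap.coe_sum,
      Finset.sum_apply, LinearMap.smul_apply, Module.Basis.dualBasis_apply_self]
    by_cases hii : i' = i
    · subst hii
      simp
    · have h3 : ∀ x y, (⟨i', x⟩ : Σ i, Fin (b i).rows) ≠ ⟨i, y⟩ := fun x y h =>
        hii (congrArg Sigma.fst h)
      have h4 : ∀ x y, (⟨i', x⟩ : Σ i, Fin (b i).cols) ≠ ⟨i, y⟩ := fun x y h =>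
        hii (congrArg Sigma.fst h)
      simp [h3, h4]
  refine ⟨w.dualBasis.reindex (Equiv.sigmaCongrRight fun i => (b i).rowsEquiv),
    u.dualBasis.reindex (Equiv.sigmaCongrRight fun i => (b i).colsEquiv), fun i j => ?_,
    fun i j => ?_⟩
  · obtain ⟨k, rfl⟩ := (b i).rowsEquiv.surjective j
    rw [← Equiv.sum_comp (b i).colsEquiv]
    simp only [Block.matA_dual, Module.Basis.reindex_apply, Equiv.sigmaCongrRight_symm,
      Equiv.sigmaCongrRight_apply, Equiv.symm_apply_apply]
    exact key A (fun i => (b i).matA) h1 i k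
  · obtain ⟨k, rfl⟩ := (b i).rowsEquiv.surjective j
    rw [← Equiv.sum_comp (b i).colsEquiv]
    simp only [Block.matB_dual, Module.Basis.reindex_apply, Equiv.sigmaCongrRight_symm,
      Equiv.sigmaCongrRight_apply, Equiv.symm_apply_apply]
    exact key B (fun i => (b i).matB) h2 i k

theorem HasBlockForm.of_dualMap [FiniteDimensional ℂ U] [FiniteDimensional ℂ W]
    {ι : Type} [Fintype ι] {A B : U →ₗ[ℂ] W} {b : ι → Block}
    (h : HasBlockForm A.dualMap B.dualMap b) : HasBlockForm A B (fun i => (b i).dual) :=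
  h.dualMap.map (Module.evalEquiv ℂ U).symm (Module.evalEquiv ℂ W).symm
    (fun x => by
      obtain ⟨x, rfl⟩ := (Module.evalEquiv ℂ U).surjective x
      rw [LinearEquiv.symm_apply_apply, LinearEquiv.eq_symm_apply]; rfl)
    (fun x => by
      obtain ⟨x, rfl⟩ := (Module.evalEquiv ℂ U).surjective x
      rw [LinearEquiv.symm_apply_apply, LinearEquiv.eq_symm_apply]; rfl)

/-- The model pencil of a single block. -/
theorem hasBlockForm_single (β : Block) :
    HasBlockForm (Matrix.toLin' β.matA) (Matrix.toLin' β.matB) (fun _ : Unit => β) := by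
  refine ⟨(Pi.basisFun ℂ _).reindex (Equiv.uniqueSigma fun _ : Unit => Fin β.cols).symm,
    (Pi.basisFun ℂ _).reindex (Equiv.uniqueSigma fun _ : Unit => Fin β.rows).symm,
    fun i j => ?_, fun i j => ?_⟩
  · ext k
    simp [Equiv.uniqueSigma, Finset.sum_apply, Pi.single_apply]
  · ext k
    simp [Equiv.uniqueSigma, Finset.sum_apply, Pi.single_apply]

end BlockForm

/-! ### Splitting off a block -/

section Split

variable {U W : Type*} [AddCommGroup U] [Module ℂ U] [AddCommGroup W] [Module ℂ W]

/-- A retraction onto `Y` splits `X` as `Y × ker π`. -/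
def equivProdKer {X Y : Type*} [AddCommGroup X] [Module ℂ X] [AddCommGroup Y] [Module ℂ Y]
    (i : Y →ₗ[ℂ] X) (π : X →ₗ[ℂ] Y) (h : ∀ y, π (i y) = y) :
    (Y × LinearMap.ker π) ≃ₗ[ℂ] X where
  toFun p := i p.1 + p.2
  map_add' p q := by simp; abel
  map_smul' t p := by simp
  invFun x := (π x, ⟨x - i (π x), by simp [h]⟩)
  left_inv p := by
    have h2 : π (p.2 : X) = 0 := p.2.2
    ext <;> simp [h, h2]
  right_inv x := by simp

theorem HasBlockForm.of_retract {β : Block} {A B : U →ₗ[ℂ] W}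
    {iU : (Fin β.cols → ℂ) →ₗ[ℂ] U} {iW : (Fin β.rows → ℂ) →ₗ[ℂ] W}
    {πU : U →ₗ[ℂ] (Fin β.cols → ℂ)} {πW : W →ₗ[ℂ] (Fin β.rows → ℂ)}
    (hiA : ∀ p, A (iU p) = iW (Matrix.toLin' β.matA p))
    (hiB : ∀ p, B (iU p) = iW (Matrix.toLin' β.matB p))
    (hA : ∀ u ∈ LinearMap.ker πU, A u ∈ LinearMap.ker πW)
    (hB : ∀ u ∈ LinearMap.ker πU, B u ∈ LinearMap.ker πW)
    (hU : ∀ p, πU (iU p) = p) (hW : ∀ p, πW (iW p) = p) {κ : Type} {b : κ → Block}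
    (h : HasBlockForm (A.restrict hA) (B.restrict hB) b) :
    HasBlockForm A B (Sum.elim (fun _ : Unit => β) b) :=
  ((hasBlockForm_single β).prodMap h).map (equivProdKer iU πU hU) (equivProdKer iW πW hW)
    (fun x => by simp [equivProdKer, hiA]) (fun x => by simp [equivProdKer, hiB])

/-- The vectors c, w map the model block into the pencil, and the functionals x, y map the pencil to
the model block. The composite is the endomorphism (G, H) of the block, G and H being the two
pairing matrices. If both are invertible, composing the first map with the inverse endomorphism
yields a section, and the kernel of the second map is a complementary subpencil. -/
theorem exists_split [FiniteDimensional ℂ U] [FiniteDimensional ℂ W] (β : Block)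
    {A B : U →ₗ[ℂ] W} (c : Fin β.cols → U) (w : Fin β.rows → W)
    (x : Fin β.cols → Module.Dual ℂ U) (y : Fin β.rows → Module.Dual ℂ W)
    (hcA : ∀ j, A (c j) = ∑ k, β.matA k j • w k) (hcB : ∀ j, B (c j) = ∑ k, β.matB k j • w k)
    (hyA : ∀ k u, y k (A u) = ∑ j, β.matA k j * x j u)
    (hyB : ∀ k u, y k (B u) = ∑ j, β.matB k j * x j u)
    (hx : (Matrix.of fun i j => x i (c j)).det ≠ 0)
    (hy : (Matrix.of fun i j => y i (w j)).det ≠ 0) :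
    ∃ (U' : Submodule ℂ U) (W' : Submodule ℂ W) (hA : ∀ u ∈ U', A u ∈ W')
      (hB : ∀ u ∈ U', B u ∈ W'),
      Module.finrank ℂ U' + β.cols = Module.finrank ℂ U ∧
      Module.finrank ℂ W' + β.rows = Module.finrank ℂ W ∧
      ∀ (κ : Type) (b : κ → Block), HasBlockForm (A.restrict hA) (B.restrict hB) b →
        HasBlockForm A B (Sum.elim (fun _ : Unit => β) b) := by
  set G := Matrix.of fun i j => x i (c j) with hG
  set H := Matrix.of fun i j => y i (w j) with hH
  let πU : U →ₗ[ℂ] (Fin β.cols → ℂ) := LinearMap.pi x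
  let πW : W →ₗ[ℂ] (Fin β.rows → ℂ) := LinearMap.pi y
  have hπA : ∀ u, πW (A u) = β.matA.mulVec (πU u) := fun u => funext fun k => hyA k u
  have hπB : ∀ u, πW (B u) = β.matB.mulVec (πU u) := fun u => funext fun k => hyB k u
  have hπc : ∀ p : Fin β.cols → ℂ, πU (Fintype.linearCombination ℂ c p) = G.mulVec p := by
    intro p
    funext i
    simp [πU, Fintype.linearCombination_apply, Matrix.mulVec, dotProduct, hG, mul_comm]
  have hπw : ∀ p : Fin β.rows → ℂ, πW (Fintype.linearCombination ℂ w p) = H.mulVec p := by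
    intro p
    funext i
    simp [πW, Fintype.linearCombination_apply, Matrix.mulVec, dotProduct, hH, mul_comm]
  have hA' : ∀ p, A (Fintype.linearCombination ℂ c p) =
      Fintype.linearCombination ℂ w (β.matA.mulVec p) := by
    intro p
    simp only [Fintype.linearCombination_apply, map_sum, map_smul, hcA, Matrix.mulVec, dotProduct,
      Finset.sum_smul, Finset.smul_sum, smul_smul]
    rw [Finset.sum_comm]
    simp only [mul_comm]
  have hB' : ∀ p, B (Fintype.linearCombination ℂ c p) =
      Fintype.linearCombination ℂ w (β.matB.mulVec p) := by
    intro p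
    simp only [Fintype.linearCombination_apply, map_sum, map_smul, hcB, Matrix.mulVec, dotProduct,
      Finset.sum_smul, Finset.smul_sum, smul_smul]
    rw [Finset.sum_comm]
    simp only [mul_comm]
  -- The pair (G, H) commutes with both block matrices, hence so does its inverse; this is what
  -- keeps the corrected embedding a morphism of pencils.
  have hGA : H * β.matA = β.matA * G := by
    refine Matrix.ext_of_mulVec_single fun j => ?_
    rw [← Matrix.mulVec_mulVec, ← Matrix.mulVec_mulVec, ← hπw, ← hπc, ← hA', hπA]
  have hGB : H * β.matB = β.matB * G := by
    refine Matrix.ext_of_mulVec_single fun j => ?_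
    rw [← Matrix.mulVec_mulVec, ← Matrix.mulVec_mulVec, ← hπw, ← hπc, ← hB', hπB]
  have hGu : IsUnit G.det := hx.isUnit
  have hHu : IsUnit H.det := hy.isUnit
  have hinv : ∀ M : Matrix (Fin β.rows) (Fin β.cols) ℂ, H * M = M * G → M * G⁻¹ = H⁻¹ * M := by
    intro M hM
    calc M * G⁻¹ = H⁻¹ * (H * M) * G⁻¹ := by rw [Matrix.nonsing_inv_mul_cancel_left _ _ hHu]
      _ = H⁻¹ * M := by rw [hM, ← Matrix.mul_assoc, Matrix.mul_nonsing_inv_cancel_right _ _ hGu]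
  let iU : (Fin β.cols → ℂ) →ₗ[ℂ] U := Fintype.linearCombination ℂ c ∘ₗ Matrix.toLin' G⁻¹
  let iW : (Fin β.rows → ℂ) →ₗ[ℂ] W := Fintype.linearCombination ℂ w ∘ₗ Matrix.toLin' H⁻¹
  have hU : ∀ p, πU (iU p) = p := fun p => by
    simp only [iU, LinearMap.comp_apply, hπc, Matrix.toLin'_apply, Matrix.mulVec_mulVec,
      Matrix.mul_nonsing_inv _ hGu, Matrix.one_mulVec]
  have hW : ∀ p, πW (iW p) = p := fun p => by
    simp only [iW, LinearMap.comp_apply, hπw, Matrix.toLin'_apply, Matrix.mulVec_mulVec,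
      Matrix.mul_nonsing_inv _ hHu, Matrix.one_mulVec]
  have hAK : ∀ u ∈ LinearMap.ker πU, A u ∈ LinearMap.ker πW := fun u hu => by
    rw [LinearMap.mem_ker] at hu ⊢
    rw [hπA, hu, Matrix.mulVec_zero]
  have hBK : ∀ u ∈ LinearMap.ker πU, B u ∈ LinearMap.ker πW := fun u hu => by
    rw [LinearMap.mem_ker] at hu ⊢
    rw [hπB, hu, Matrix.mulVec_zero]
  refine ⟨LinearMap.ker πU, LinearMap.ker πW, hAK, hBK, ?_, ?_, fun κ b hb => ?_⟩
  · have := (equivProdKer iU πU hU).finrank_eq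
    rw [Module.finrank_prod, Module.finrank_fin_fun] at this
    omega
  · have := (equivProdKer iW πW hW).finrank_eq
    rw [Module.finrank_prod, Module.finrank_fin_fun] at this
    omega
  · refine HasBlockForm.of_retract (iU := iU) (iW := iW) (fun p => ?_) (fun p => ?_) hAK hBK hU hW hb
    · simp only [iU, iW, LinearMap.comp_apply, hA', Matrix.toLin'_apply, Matrix.mulVec_mulVec,
        hinv _ hGA]
    · simp only [iU, iW, LinearMap.comp_apply, hB', Matrix.toLin'_apply, Matrix.mulVec_mulVec,
        hinv _ hGB]

theorem det_toeplitz_ne_zero {n : ℕ} {g : ℕ → ℂ} (h : g 0 ≠ 0) :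
    (Matrix.of fun i j : Fin n => if (i : ℕ) ≤ j then g (j - i) else 0).det ≠ 0 := by
  rw [Matrix.det_of_isUpperTriangular]
  · simp [h]
  · intro i j hij
    have : ¬ (i : ℕ) ≤ j := by simpa using hij
    simp only [Matrix.of_apply, if_neg this]

/-- The existence of a block which splits off. -/
def Splits (A B : U →ₗ[ℂ] W) : Prop :=
  ∃ (β : Block) (U' : Submodule ℂ U) (W' : Submodule ℂ W) (hA : ∀ u ∈ U', A u ∈ W')
    (hB : ∀ u ∈ U', B u ∈ W'),
    Module.finrank ℂ U' + Module.finrank ℂ W' < Module.finrank ℂ U + Module.finrank ℂ W ∧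
    ∀ (κ : Type) (b : κ → Block), HasBlockForm (A.restrict hA) (B.restrict hB) b →
      HasBlockForm A B (Sum.elim (fun _ : Unit => β) b)

theorem Block.rows_add_cols_pos (β : Block) : 0 < β.cols + β.rows := by
  rcases β with _ | _ | _ <;> simp [Block.rows, Block.cols]

theorem splits_of_functionals [FiniteDimensional ℂ U] [FiniteDimensional ℂ W] (β : Block)
    {A B : U →ₗ[ℂ] W} (c : Fin β.cols → U) (w : Fin β.rows → W)
    (x : Fin β.cols → Module.Dual ℂ U) (y : Fin β.rows → Module.Dual ℂ W)
    (hcA : ∀ j, A (c j) = ∑ k, β.matA k j • w k) (hcB : ∀ j, B (c j) = ∑ k, β.matB k j • w k)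
    (hyA : ∀ k u, y k (A u) = ∑ j, β.matA k j * x j u)
    (hyB : ∀ k u, y k (B u) = ∑ j, β.matB k j * x j u)
    (hx : (Matrix.of fun i j => x i (c j)).det ≠ 0)
    (hy : (Matrix.of fun i j => y i (w j)).det ≠ 0) : Splits A B := by
  obtain ⟨U', W', hA, hB, h1, h2, h3⟩ := exists_split β c w x y hcA hcB hyA hyB hx hy
  have := β.rows_add_cols_pos
  exact ⟨β, U', W', hA, hB, by omega, h3⟩

theorem sum_ite_smul_eq {M : Type*} [AddCommGroup M] [Module ℂ M] {n : ℕ} (f : ℕ → M)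
    (p : ℕ → Prop) [DecidablePred p] (j : ℕ) (hp : ∀ k < n, p k ↔ k = j) :
    ∑ k : Fin n, (if p k then (1 : ℂ) else 0) • f k = if j < n then f j else 0 := by
  have : ∀ k : Fin n, (if p k then (1 : ℂ) else 0) • f k = if (k : ℕ) = j then f k else 0 :=
    fun k => by rw [ite_smul, one_smul, zero_smul]; exact if_congr (hp k k.2) rfl rfl
  simp only [this]
  rw [Fin.sum_univ_eq_sum_range (fun k => if k = j then f k else 0)]
  simp

end Split

/-! ### The Kronecker canonical form -/

section Kronecker

variable {U W : Type*} [AddCommGroup U] [Module ℂ U] [AddCommGroup W] [Module ℂ W]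

theorem chainSpace_bot_succ (P Q : U →ₗ[ℂ] W) (k : ℕ) :
    chainSpace P Q ⊥ (k + 1) = chainSpace P Q (LinearMap.ker Q) k := by
  induction k with
  | zero => rw [chainSpace, chainSpace, chainSpace, Submodule.map_bot]; rfl
  | succ k ih => rw [chainSpace, ih]; rfl

/-- A terminating chain of minimal length k spans a copy of `hor k`, with rows A v_j for j < k.
Minimality says that its first vector starts no shorter chain ending in ker A, and duality turns
this into functionals that split the copy off. -/
theorem splits_of_hasTerminatingChain [FiniteDimensional ℂ U] [FiniteDimensional ℂ W]
    {A B : U →ₗ[ℂ] W} (h : HasTerminatingChain B A) : Splits A B := by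
  classical
  obtain ⟨c, hc, hc0, hBc⟩ := Nat.find_spec h
  have hmin : ∀ m < Nat.find h, c ∉ chainSpace B A (LinearMap.ker A) m := fun m hm hcm =>
    Nat.find_min h hm ⟨c, hcm, hc0, hBc⟩
  generalize Nat.find h = k at hc hmin
  obtain ⟨v, hv0, hv, hvk⟩ := exists_chain hc
  rw [LinearMap.mem_ker] at hvk
  subst hv0
  obtain ⟨x, y, hx0, hx, hxA, hxB⟩ : ∃ (x : ℕ → Module.Dual ℂ U) (y : ℕ → Module.Dual ℂ W),
      x 0 (v 0) ≠ 0 ∧ (∀ i j, i ≤ k → j ≤ k → x i (v j) = if i ≤ j then x 0 (v (j - i)) else 0) ∧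
      (∀ i < k, ∀ u, y i (A u) = x i u) ∧ ∀ i < k, ∀ u, y i (B u) = x (i + 1) u := by
    cases k with
    | zero =>
      obtain ⟨φ, hφ⟩ := Module.Projective.exists_dual_ne_zero ℂ hc0
      refine ⟨fun _ => φ, fun _ => 0, hφ, fun i j hi hj => ?_, by simp, by simp⟩
      obtain rfl : i = 0 := by omega
      simp
    | succ n =>
      have hn := hmin n (by omega)
      -- Ending in ker A is the same as continuing by one step to 0. With F = ⊥ the end condition on
      -- the functionals is empty, as there is no constraint beyond the last row of a horizontal
      -- block.
      rw [← chainSpace_bot_succ] at hn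
      obtain ⟨y, hy0, hy, -⟩ := exists_dual_chain_of_notMem hn
      -- There is one more column than rows, so the column functionals are y_0 ∘ A followed by all
      -- the y_i ∘ B = x_(i+1).
      refine ⟨fun i => Nat.casesOn i (y 0 ∘ₗ A) fun i => y i ∘ₗ B, y, hy0, ?_, ?_,
        fun _ _ _ => rfl⟩
      · rintro (_ | i) j hi hj
        · simp
        · cases j with
          | zero => simp [hBc]
          | succ j =>
            have := dual_chain_apply hBc hv hy (i := i) (j := j) (by omega) (by omega)
            simpa [hv j (by omega)] using this
      · rintro (_ | i) hi u
        · rfl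
        · exact (LinearMap.congr_fun (hy i (by omega)) u).symm
  refine splits_of_functionals (Block.hor k) (fun j => v j) (fun j => A (v j)) (fun j => x j)
    (fun j => y j) ?_ ?_ ?_ ?_ ?_ ?_
  · rintro ⟨j, hj⟩
    have hj : j < k + 1 := hj
    refine Eq.trans ?_ (sum_ite_smul_eq (fun i => A (v i)) (fun i => i = j) j
      fun _ _ => Iff.rfl).symm
    split_ifs with h'
    · rfl
    · obtain rfl : j = k := by change ¬ j < k at h'; omega
      exact hvk
  · rintro ⟨_ | j, hj⟩
    · refine Eq.trans hBc (Finset.sum_eq_zero fun i _ => ?_).symm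
      exact zero_smul _ _
    · have hj : j < k := Nat.lt_of_succ_lt_succ hj
      refine Eq.trans (hv j hj) (Eq.trans ?_ (sum_ite_smul_eq (fun i => A (v i))
        (fun i => i + 1 = j + 1) j fun _ _ => by omega).symm)
      exact (if_pos hj).symm
  · rintro ⟨i, hi⟩ u
    have hi : i < k := hi
    refine Eq.trans (hxA i hi u) (Eq.trans ?_ (sum_ite_smul_eq (fun j => x j u)
        (fun j => i = j) i fun _ _ => eq_comm).symm)
    exact (if_pos (Nat.lt_succ_of_lt hi)).symm
  · rintro ⟨i, hi⟩ u
    have hi : i < k := hi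
    refine Eq.trans (hxB i hi u) (Eq.trans ?_ (sum_ite_smul_eq (fun j => x j u)
        (fun j => i + 1 = j) (i + 1) fun _ _ => eq_comm).symm)
    exact (if_pos (Nat.succ_lt_succ hi)).symm
  · refine fun h => det_toeplitz_ne_zero (n := k + 1) (g := fun j => x 0 (v j)) hx0
      (Eq.trans (congrArg Matrix.det (Matrix.ext fun i j => ?_)) h)
    exact (hx i j (Nat.le_of_lt_succ i.2) (Nat.le_of_lt_succ j.2)).symm
  · refine fun h => det_toeplitz_ne_zero (n := k) (g := fun j => x 0 (v j)) hx0
      (Eq.trans (congrArg Matrix.det (Matrix.ext fun i j => ?_)) h)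
    exact ((hxA i i.2 _).trans (hx i j i.2.le j.2.le)).symm

/-- A longest chain starting in `ker P` is dual to a chain of functionals. -/
theorem exists_jordan_data [FiniteDimensional ℂ U] [FiniteDimensional ℂ W] {P Q : U →ₗ[ℂ] W}
    (hno : ¬ HasTerminatingChain P Q) (hP : ∃ c ≠ 0, P c = 0) :
    ∃ (n : ℕ) (v : ℕ → U) (y : ℕ → Module.Dual ℂ W),
      (∀ j : Fin (n + 1), Q (v j) = ∑ k : Fin (n + 1),
        (if (k : ℕ) = j then (1 : ℂ) else 0) • Q (v k)) ∧
      (∀ j : Fin (n + 1), P (v j) = ∑ k : Fin (n + 1),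
        (if (k : ℕ) + 1 = j then (1 : ℂ) else 0) • Q (v k)) ∧
      (∀ (k : Fin (n + 1)) u, y k (Q u) = ∑ j : Fin (n + 1),
        (if (k : ℕ) = j then (1 : ℂ) else 0) • y j (Q u)) ∧
      (∀ (k : Fin (n + 1)) u, y k (P u) = ∑ j : Fin (n + 1),
        (if (k : ℕ) + 1 = j then (1 : ℂ) else 0) • y j (Q u)) ∧
      (Matrix.of fun i j : Fin (n + 1) => y i (Q (v j))).det ≠ 0 := by
  classical
  have hex : ∃ k, ∀ c ∈ chainSpace P Q ⊤ k, P c = 0 → c = 0 := exists_chainSpace_top_disjoint hno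
  have hspec := Nat.find_spec hex
  have hmin := fun m hm => Nat.find_min hex (m := m) hm
  generalize Nat.find hex = k at hspec hmin
  cases k with
  | zero =>
    obtain ⟨c, hc, hPc⟩ := hP
    exact absurd (hspec c Submodule.mem_top hPc) hc
  | succ n =>
    -- At the least length n + 1 beyond which no chain leaves ker P, some c in ker P still starts a
    -- chain of n steps but none of n + 1 steps. The dual chain that detects this ends with y_n ∘ P
    -- = 0, the boundary condition of a Jordan block of size n + 1.
    have hn := hmin n (by omega)
    push Not at hn
    obtain ⟨c, hc, hPc, hc0⟩ := hn
    obtain ⟨y, hy0, hy, hyn⟩ := exists_dual_chain_of_notMem fun hc' => hc0 (hspec c hc' hPc)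
    obtain ⟨v, rfl, hv, -⟩ := exists_chain hc
    refine ⟨n, v, y, fun j => ?_, fun j => ?_, fun k u => ?_, fun k u => ?_, ?_⟩
    · rw [sum_ite_smul_eq (fun i => Q (v i)) (fun i => i = j) j fun _ _ => Iff.rfl, if_pos j.2]
    · obtain ⟨_ | j, hj⟩ := j
      · simp [hPc]
      · have := sum_ite_smul_eq (n := n + 1) (fun i => Q (v i)) (fun i => i + 1 = j + 1) j
          fun _ _ => by omega
        rw [hv j (by omega)]
        simp only [this, if_pos (show j < n + 1 by omega)]
    · rw [sum_ite_smul_eq (fun i => y i (Q u)) (fun i => (k : ℕ) = i) k fun _ _ => eq_comm,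
        if_pos k.2]
    · rw [sum_ite_smul_eq (fun i => y i (Q u)) (fun i => (k : ℕ) + 1 = i) (k + 1)
        fun _ _ => eq_comm]
      split_ifs with hk
      · exact LinearMap.congr_fun (hy k (by omega)) u
      · rw [show (k : ℕ) = n by omega, hyn u Submodule.mem_top]
    · convert det_toeplitz_ne_zero (n := n + 1) (g := fun j => y 0 (Q (v j))) hy0 using 2
      ext i j
      exact dual_chain_apply hPc hv hy (Nat.le_of_lt_succ i.2) (Nat.le_of_lt_succ j.2)

theorem splits_jordan_infty [FiniteDimensional ℂ U] [FiniteDimensional ℂ W] {A B : U →ₗ[ℂ] W}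
    (hno : ¬ HasTerminatingChain B A) (hB : ∃ c ≠ 0, B c = 0) : Splits A B := by
  obtain ⟨n, v, y, h1, h2, h3, h4, h5⟩ := exists_jordan_data hno hB
  exact splits_of_functionals (Block.jordan OnePoint.infty n) (fun j => v j) (fun j => A (v j))
    (fun j => y j ∘ₗ A) (fun j => y j) h1 h2 h3 h4 h5 h5

/-- The pair (A - zB, B) has a nilpotent Jordan block; adding zB back shifts its eigenvalue to z. -/
theorem splits_jordan [FiniteDimensional ℂ U] [FiniteDimensional ℂ W] {A B : U →ₗ[ℂ] W} (z : ℂ)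
    (hno : ¬ HasTerminatingChain (A - z • B) B) (hB : ∃ c ≠ 0, (A - z • B) c = 0) :
    Splits A B := by
  obtain ⟨n, v, y, h1, h2, h3, h4, h5⟩ := exists_jordan_data hno hB
  have hent : ∀ k j : Fin (n + 1), (Block.jordan (OnePoint.some z) n).matA k j =
      z * (if (k : ℕ) = j then (1 : ℂ) else 0) + if (k : ℕ) + 1 = j then (1 : ℂ) else 0 := by
    intro k j
    change (if (k : ℕ) = j then z else if (k : ℕ) + 1 = j then 1 else 0) = _
    by_cases h : (k : ℕ) = j
    · simp [h]
    · simp [h]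
  refine splits_of_functionals (Block.jordan (OnePoint.some z) n) (fun j => v j)
    (fun j => B (v j)) (fun j => y j ∘ₗ B) (fun j => y j) (fun j => ?_) h1 (fun k u => ?_) h3 h5 h5
  · have h := h2 j
    rw [LinearMap.sub_apply, sub_eq_iff_eq_add, LinearMap.smul_apply, h1 j] at h
    rw [h, Finset.smul_sum, ← Finset.sum_add_distrib]
    refine Finset.sum_congr rfl fun k _ => ?_
    exact ((congrArg (· • B (v k)) (hent k j)).trans (by rw [add_smul, mul_smul, add_comm])).symm
  · have h := h4 k u
    rw [LinearMap.sub_apply, map_sub, sub_eq_iff_eq_add, LinearMap.smul_apply, map_smul, h3 k] at h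
    rw [h, Finset.smul_sum, ← Finset.sum_add_distrib]
    refine Finset.sum_congr rfl fun j _ => ?_
    exact ((congrArg (· • y j (B u)) (hent k j)).trans (by rw [add_smul, mul_smul, add_comm])).symm

theorem not_hasTerminatingChain_of_injective {P Q : U →ₗ[ℂ] W} (hQ : Function.Injective Q) :
    ¬ HasTerminatingChain P Q := by
  rintro ⟨k, c, hc, hc0, -⟩
  have hker : LinearMap.ker Q = ⊥ := LinearMap.ker_eq_bot.2 hQ
  have : ∀ k, chainSpace P Q (LinearMap.ker Q) k = ⊥ := by
    intro k
    induction k with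
    | zero => exact hker
    | succ k ih => rw [chainSpace, ih, Submodule.map_bot]; exact hker
  rw [this, Submodule.mem_bot] at hc
  exact hc0 hc

/-- If neither the pencil nor the transposed pencil has a Kronecker block, then a Jordan block
splits off. -/
theorem splits_of_regular [FiniteDimensional ℂ U] [FiniteDimensional ℂ W] [Nontrivial U]
    {A B : U →ₗ[ℂ] W} (hno : ¬ HasTerminatingChain B A)
    (hdim : Module.finrank ℂ U = Module.finrank ℂ W) : Splits A B := by
  -- If B is invertible, B⁻¹A has an eigenvalue, which is the finite eigenvalue of a block;
  -- otherwise ker B supplies a block at infinity.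
  by_cases hB : Function.Injective B
  · let e : U ≃ₗ[ℂ] W := LinearEquiv.ofInjectiveOfFinrankEq B hB hdim
    obtain ⟨z, hz⟩ := Module.End.exists_eigenvalue (e.symm.toLinearMap ∘ₗ A)
    obtain ⟨c, hc⟩ := hz.exists_hasEigenvector
    refine splits_jordan z (not_hasTerminatingChain_of_injective hB) ⟨c, hc.2, ?_⟩
    have h1 : e.symm (A c) = z • c := hc.apply_eq_smul
    rw [LinearEquiv.symm_apply_eq, map_smul] at h1
    rw [LinearMap.sub_apply, h1, LinearMap.smul_apply, sub_eq_zero]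
    rfl
  · refine splits_jordan_infty hno ?_
    rw [← LinearMap.ker_eq_bot, Submodule.eq_bot_iff] at hB
    push Not at hB
    obtain ⟨c, hc, hc0⟩ := hB
    exact ⟨c, hc0, hc⟩

/-- Induction on dim U + dim W. A terminating chain splits off a horizontal block, one of the
transposed pencil a vertical block. If neither exists, then dim U = dim W and a Jordan block splits
off. -/
theorem exists_hasBlockForm_of_finrank_le (d : ℕ) : ∀ (U W : Type) [AddCommGroup U] [Module ℂ U]
    [AddCommGroup W] [Module ℂ W] [FiniteDimensional ℂ U] [FiniteDimensional ℂ W]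
    (A B : U →ₗ[ℂ] W), Module.finrank ℂ U + Module.finrank ℂ W ≤ d →
    ∃ (N : ℕ) (b : Fin N → Block), HasCanonicalForm A B b := by
  induction d with
  | zero =>
    intro U W _ _ _ _ _ _ A B h
    have hU : Subsingleton U := Module.finrank_zero_iff.1 (by omega : Module.finrank ℂ U = 0)
    have hW : Subsingleton W := Module.finrank_zero_iff.1 (by omega : Module.finrank ℂ W = 0)
    exact ⟨0, Fin.elim0, Module.Basis.empty _, Module.Basis.empty _, by ext i; exact i.1.elim0,
      by ext i; exact i.1.elim0⟩
  | succ d ih =>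
    have hsplit : ∀ (U W : Type) [AddCommGroup U] [Module ℂ U]
        [AddCommGroup W] [Module ℂ W] [FiniteDimensional ℂ U] [FiniteDimensional ℂ W]
        (A B : U →ₗ[ℂ] W), Module.finrank ℂ U + Module.finrank ℂ W ≤ d + 1 → Splits A B →
        ∃ (N : ℕ) (b : Fin N → Block), HasCanonicalForm A B b := by
      intro U W _ _ _ _ _ _ A B h ⟨β, U', W', hA, hB, hlt, hf⟩
      obtain ⟨N, b, hb⟩ := ih U' W' (A.restrict hA) (B.restrict hB) (by omega)
      exact (hf _ b (hasCanonicalForm_iff.1 hb)).exists_hasCanonicalForm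
    intro U W _ _ _ _ _ _ A B h
    by_cases h1 : HasTerminatingChain B A
    · exact hsplit U W A B h (splits_of_hasTerminatingChain h1)
    by_cases h2 : HasTerminatingChain B.dualMap A.dualMap
    · obtain ⟨N, b, hb⟩ := hsplit _ _ A.dualMap B.dualMap
        (by rw [Subspace.dual_finrank_eq, Subspace.dual_finrank_eq]; omega)
        (splits_of_hasTerminatingChain h2)
      exact ⟨N, _, hasCanonicalForm_iff.2 (hasCanonicalForm_iff.1 hb).of_dualMap⟩
    have hdim : Module.finrank ℂ U = Module.finrank ℂ W := by
      refine le_antisymm (not_lt.1 fun hlt => h1 (hasTerminatingChain_of_finrank_lt B A hlt))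
        (not_lt.1 fun hlt => h2 (hasTerminatingChain_of_finrank_lt _ _ ?_))
      rwa [Subspace.dual_finrank_eq, Subspace.dual_finrank_eq]
    rcases subsingleton_or_nontrivial U with hU | hU
    · exact ih U W A B (by rw [← hdim, Module.finrank_zero_of_subsingleton]; omega)
    · exact hsplit U W A B h (splits_of_regular h1 hdim)

/-- Every pencil has a Kronecker canonical form. -/
theorem exists_hasCanonicalForm [FiniteDimensional ℂ U] [FiniteDimensional ℂ W]
    (A B : U →ₗ[ℂ] W) : ∃ (N : ℕ) (b : Fin N → Block), HasCanonicalForm A B b := by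
  let f := (Module.finBasis ℂ U).equivFun
  let g := (Module.finBasis ℂ W).equivFun
  obtain ⟨N, b, hb⟩ := exists_hasBlockForm_of_finrank_le _ _ _
    (g.toLinearMap ∘ₗ A ∘ₗ f.symm.toLinearMap) (g.toLinearMap ∘ₗ B ∘ₗ f.symm.toLinearMap) le_rfl
  exact ⟨N, b, hasCanonicalForm_iff.2 ((hasCanonicalForm_iff.1 hb).map f.symm g.symm
    (fun x => by simp) (fun x => by simp))⟩

end Kronecker

/-! ### Kernels of the members of a pencil in canonical form -/

namespace Block

/-- The member `A + t B` of the model pencil. -/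
def matAt (b : Block) (t : ℂ) : Matrix (Fin b.rows) (Fin b.cols) ℂ :=
  b.matA + t • b.matB

/-- The dimension of the kernel of the generic member of the pencil. -/
def horCount : Block → ℕ
  | hor _ => 1
  | _ => 0

/-- `t` is a singular parameter of a Jordan block. -/
def IsEigen (t : ℂ) : Block → Prop
  | jordan μ _ => μ = OnePoint.some (-t)
  | _ => False

theorem matAt_hor_apply (ε : ℕ) (t : ℂ) (p : ℕ → ℂ) (k : Fin (hor ε).rows) :
    ((hor ε).matAt t).mulVec (fun j => p j) k = p k + t * p (k + 1) := by
  have hk : (k : ℕ) < ε := k.2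
  have h1 := sum_ite_smul_eq (n := ε + 1) p (fun j => (k : ℕ) = j) k fun _ _ => eq_comm
  have h2 := sum_ite_smul_eq (n := ε + 1) p (fun j => (k : ℕ) + 1 = j) (k + 1) fun _ _ => eq_comm
  rw [if_pos (by omega)] at h1 h2
  rw [matAt, Matrix.add_mulVec, Matrix.smul_mulVec]
  exact congrArg₂ (fun x y => x + t * y) h1 h2

theorem exists_extension {n : ℕ} (p : Fin n → ℂ) : ∃ q : ℕ → ℂ, p = fun j : Fin n => q j :=
  ⟨fun k => if h : k < n then p ⟨k, h⟩ else 0, by ext j; simp⟩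

theorem exists_eq_hor {b : Block} (h : b.horCount = 1) : ∃ ε, b = hor ε := by
  rcases b with _ | ε | _
  · exact absurd h zero_ne_one
  · exact ⟨ε, rfl⟩
  · exact absurd h zero_ne_one

theorem horCols_eq (b : Block) : b.horCols = if b.horCount = 1 then b.cols else 0 := by
  rcases b with _ | _ | _ <;> simp [horCount, horCols, cols]

theorem pow_mem_ker_matAt {b : Block} {ε : ℕ} (hb : b = hor ε) (t : ℂ) :
    (fun j : Fin b.cols => (-t) ^ (ε - j : ℕ)) ∈ LinearMap.ker (Matrix.toLin' (b.matAt t)) := by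
  subst hb
  rw [LinearMap.mem_ker, Matrix.toLin'_apply]
  ext k
  have hk : (k : ℕ) < ε := k.2
  rw [matAt_hor_apply ε t (fun j => (-t) ^ (ε - j))]
  simp only [show ε - (k : ℕ) = ε - (k + 1) + 1 by omega, pow_succ, Pi.zero_apply]
  ring

theorem finrank_ker_matAt_hor (ε : ℕ) (t : ℂ) :
    Module.finrank ℂ (LinearMap.ker (Matrix.toLin' ((hor ε).matAt t))) = 1 := by
  refine (finrank_eq_one_iff_of_nonzero' ⟨_, pow_mem_ker_matAt rfl t⟩ fun h => ?_).2 ?_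
  · have := congrFun (congrArg Subtype.val h) (Fin.last ε)
    simp at this
    exact one_ne_zero this
  · rintro ⟨p, hp⟩
    obtain ⟨q, rfl⟩ := exists_extension p
    rw [LinearMap.mem_ker, Matrix.toLin'_apply] at hp
    have hq : ∀ k < ε, q k = -t * q (k + 1) := fun k hk => by
      have := congrFun hp ⟨k, hk⟩
      rw [matAt_hor_apply, Pi.zero_apply] at this
      linear_combination this
    have hq' : ∀ d ≤ ε, q (ε - d) = (-t) ^ d * q ε := by
      intro d
      induction d with
      | zero => simp
      | succ d ih =>
        intro hd
        rw [hq _ (by omega), show ε - (d + 1) + 1 = ε - d by omega, ih (by omega)]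
        ring
    refine ⟨q ε, Subtype.ext (funext fun j => ?_)⟩
    have hj : (j : ℕ) ≤ ε := Nat.le_of_lt_succ j.2
    have := hq' (ε - j) (by omega)
    rw [show ε - (ε - (j : ℕ)) = j by omega] at this
    change q ε * (-t) ^ (ε - j : ℕ) = q j
    rw [this, mul_comm]

/-- Jordan blocks are triangular with diagonal 1 (eigenvalue infinity) or z + t; for vertical blocks
the coordinates vanish one after another, starting from the first row. -/
theorem matAt_injective {b : Block} {t : ℂ} (hb : b.horCount = 0) (ht : ¬ b.IsEigen t)
    {p : Fin b.cols → ℂ} (hp : (b.matAt t).mulVec p = 0) : p = 0 := by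
  rcases b with ⟨_ | z, n⟩ | ε | η
  · let M : Matrix (Fin (n + 1)) (Fin (n + 1)) ℂ := (jordan OnePoint.infty n).matAt t
    have hM : ∀ i j, M i j = (if (i : ℕ) = j then 1 else 0) + t * if (i : ℕ) + 1 = j then 1 else 0 :=
      fun _ _ => rfl
    refine Matrix.eq_zero_of_mulVec_eq_zero (M := M) ?_ hp
    rw [Matrix.det_of_isUpperTriangular]
    · simp [hM]
    · intro i j hij
      have : (j : ℕ) < i := hij
      rw [hM, if_neg (by omega), if_neg (by omega)]
      simp
  · let M : Matrix (Fin (n + 1)) (Fin (n + 1)) ℂ := (jordan (OnePoint.some z) n).matAt t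
    have hM : ∀ i j, M i j = (if (i : ℕ) = j then z else if (i : ℕ) + 1 = j then 1 else 0) +
      t * if (i : ℕ) = j then 1 else 0 := fun _ _ => rfl
    refine Matrix.eq_zero_of_mulVec_eq_zero (M := M) ?_ hp
    rw [Matrix.det_of_isUpperTriangular]
    · have : z + t ≠ 0 := fun h => ht (congrArg OnePoint.some (eq_neg_of_add_eq_zero_left h))
      simp [hM, this]
    · intro i j hij
      have : (j : ℕ) < i := hij
      rw [hM, if_neg (by omega), if_neg (by omega), if_neg (by omega)]
      simp
  · simp [horCount] at hb
  · obtain ⟨q, rfl⟩ := exists_extension p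
    have hq : ∀ k < η, q k = 0 := by
      intro k
      induction k with
      | zero =>
        intro hk
        have h := congrFun hp ⟨0, Nat.succ_pos η⟩
        rw [matAt, Matrix.add_mulVec, Matrix.smul_mulVec] at h
        have h1 := sum_ite_smul_eq (n := η) q (fun j => 0 = j) 0 fun _ _ => eq_comm
        have h2 : ∑ j : Fin η, (if 0 = (j : ℕ) + 1 then (1 : ℂ) else 0) • q j = 0 :=
          Finset.sum_eq_zero fun j _ => by simp
        have h3 : (if 0 < η then q 0 else 0) + t * 0 = 0 :=
          (congrArg₂ (fun x y => x + t * y) h1 h2).symm.trans h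
        simpa [hk] using h3
      | succ k ih =>
        intro hk
        have h := congrFun hp ⟨k + 1, Nat.lt_succ_of_lt hk⟩
        rw [matAt, Matrix.add_mulVec, Matrix.smul_mulVec] at h
        have h1 := sum_ite_smul_eq (n := η) q (fun j => k + 1 = j) (k + 1) fun _ _ => eq_comm
        have h2 := sum_ite_smul_eq (n := η) q (fun j => k + 1 = j + 1) k fun _ _ => by omega
        have h3 : (if k + 1 < η then q (k + 1) else 0) + t * (if k < η then q k else 0) = 0 :=
          (congrArg₂ (fun x y => x + t * y) h1 h2).symm.trans h
        simpa [hk, ih (by omega)] using h3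
    ext j
    exact hq j j.2

theorem finrank_ker_matAt {b : Block} {t : ℂ} (ht : ¬ b.IsEigen t) :
    Module.finrank ℂ (LinearMap.ker (Matrix.toLin' (b.matAt t))) = b.horCount := by
  by_cases hb : b.horCount = 0
  · have : LinearMap.ker (Matrix.toLin' (b.matAt t)) = ⊥ :=
      (Submodule.eq_bot_iff _).2 fun p hp => matAt_injective hb ht hp
    rw [this, finrank_bot, hb]
  · rcases b with _ | ε | _
    · exact absurd rfl hb
    · exact finrank_ker_matAt_hor ε t
    · exact absurd rfl hb

theorem horCount_lt_of_isEigen {b : Block} {t : ℂ} (ht : b.IsEigen t) :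
    b.horCount < Module.finrank ℂ (LinearMap.ker (Matrix.toLin' (b.matAt t))) := by
  rcases b with ⟨μ, n⟩ | _ | _
  · obtain rfl : μ = OnePoint.some (-t) := ht
    change 0 < _
    rw [Module.finrank_pos_iff_exists_ne_zero]
    refine ⟨⟨fun j : Fin (n + 1) => if (j : ℕ) = 0 then 1 else 0, ?_⟩, fun h => ?_⟩
    · refine funext fun i => ?_
      change ∑ j : Fin (n + 1), ((if (i : ℕ) = j then -t else if (i : ℕ) + 1 = j then 1 else 0) +
        t * if (i : ℕ) = j then 1 else 0) * (if (j : ℕ) = 0 then 1 else 0) = 0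
      refine Finset.sum_eq_zero fun j _ => ?_
      by_cases hj : (j : ℕ) = 0
      · by_cases hi : (i : ℕ) = 0 <;> simp [hj, hi]
      · simp [hj]
    · have := congrFun (congrArg Subtype.val h) (0 : Fin (n + 1))
      simp at this
      exact one_ne_zero this
  · exact ht.elim
  · exact ht.elim

end Block

/-! ### Kernels of a whole pencil and their sums -/

section KernelSum

variable {U W : Type*} [AddCommGroup U] [Module ℂ U] [AddCommGroup W] [Module ℂ W]

theorem mem_ker_iff_of_basis {ι : Type} [Fintype ι] {A B : U →ₗ[ℂ] W} {b : ι → Block}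
    {u : Module.Basis (Σ i, Fin (b i).cols) ℂ U} {w : Module.Basis (Σ i, Fin (b i).rows) ℂ W}
    (hA : ∀ i j, A (u ⟨i, j⟩) = ∑ k, (b i).matA k j • w ⟨i, k⟩)
    (hB : ∀ i j, B (u ⟨i, j⟩) = ∑ k, (b i).matB k j • w ⟨i, k⟩) (t : ℂ) (v : U) :
    v ∈ LinearMap.ker (A + t • B) ↔
      ∀ i, (fun j => u.repr v ⟨i, j⟩) ∈ LinearMap.ker (Matrix.toLin' ((b i).matAt t)) := by
  have hv : (A + t • B) v = ∑ p : Σ i, Fin (b i).rows,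
      ((b p.1).matAt t).mulVec (fun j => u.repr v ⟨p.1, j⟩) p.2 • w p := by
    conv_lhs => rw [← u.sum_repr v]
    rw [map_sum, Fintype.sum_sigma, Fintype.sum_sigma]
    refine Finset.sum_congr rfl fun i _ => ?_
    simp only [map_smul, LinearMap.add_apply, LinearMap.smul_apply, hA, hB, Finset.smul_sum,
      ← Finset.sum_add_distrib, Matrix.mulVec, dotProduct, Finset.sum_smul]
    rw [Finset.sum_comm]
    refine Finset.sum_congr rfl fun k _ => Finset.sum_congr rfl fun j _ => ?_
    simp only [smul_smul, ← add_smul, Block.matAt, Matrix.add_apply, Matrix.smul_apply,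
      smul_eq_mul]
    ring_nf
  rw [LinearMap.mem_ker, hv]
  constructor
  · intro h i
    rw [LinearMap.mem_ker, Matrix.toLin'_apply]
    ext k
    exact Fintype.linearIndependent_iff.1 w.linearIndependent _ h ⟨i, k⟩
  · intro h
    refine Finset.sum_eq_zero fun p _ => ?_
    have := congrFun (LinearMap.mem_ker.1 (h p.1)) p.2
    rw [Matrix.toLin'_apply, Pi.zero_apply] at this
    rw [this, zero_smul]

theorem HasBlockForm.finrank_ker {ι : Type} [Fintype ι] {A B : U →ₗ[ℂ] W} {b : ι → Block}
    (h : HasBlockForm A B b) (t : ℂ) :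
    Module.finrank ℂ (LinearMap.ker (A + t • B)) =
      ∑ i, Module.finrank ℂ (LinearMap.ker (Matrix.toLin' ((b i).matAt t))) := by
  obtain ⟨u, w, hA, hB⟩ := h
  rw [← Module.finrank_pi_fintype]
  let E : U ≃ₗ[ℂ] (∀ i, Fin (b i).cols → ℂ) :=
    u.equivFun ≪≫ₗ LinearEquiv.piCurry ℂ (fun (i : ι) (_ : Fin (b i).cols) => ℂ)
  have hE : ∀ v, v ∈ LinearMap.ker (A + t • B) ↔
      ∀ i, E v i ∈ LinearMap.ker (Matrix.toLin' ((b i).matAt t)) := mem_ker_iff_of_basis hA hB t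
  exact LinearEquiv.finrank_eq
    { toFun := fun v i => ⟨E v i, (hE v).1 v.2 i⟩
      map_add' := fun x y => by ext; simp
      map_smul' := fun c x => by ext; simp
      invFun := fun p => ⟨E.symm fun i => p i, (hE _).2 fun i => by simp⟩
      left_inv := fun v => by simp
      right_inv := fun p => by ext; simp }

theorem finite_setOf_isEigen {ι : Type} [Finite ι] (b : ι → Block) :
    {t : ℂ | ∃ i, (b i).IsEigen t}.Finite := by
  rw [Set.ofPred_exists]
  refine Set.finite_iUnion fun i => Set.Subsingleton.finite ?_
  intro s hs t ht
  rcases h : b i with ⟨μ, n⟩ | _ | _ <;> simp only [Set.mem_ofPred_eq, h, Block.IsEigen] at hs ht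
  rw [hs] at ht
  exact neg_injective (OnePoint.coe_injective ht)

/-- At a parameter where the kernel has the smallest dimension there is no Jordan eigenvalue, and
the dimension of the kernel is the number of horizontal blocks. -/
theorem HasBlockForm.finrank_ker_of_min {ι : Type} [Fintype ι] {A B : U →ₗ[ℂ] W} {b : ι → Block}
    (h : HasBlockForm A B b) {t : ℂ} (ht : ∀ s : ℂ, Module.finrank ℂ (LinearMap.ker (A + t • B)) ≤
      Module.finrank ℂ (LinearMap.ker (A + s • B))) :
    (∀ i, ¬ (b i).IsEigen t) ∧
      Module.finrank ℂ (LinearMap.ker (A + t • B)) = ∑ i, (b i).horCount := by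
  obtain ⟨s, hs⟩ := (finite_setOf_isEigen b).exists_notMem
  simp only [Set.mem_ofPred_eq, not_exists] at hs
  have h1 := ht s
  rw [h.finrank_ker s, Finset.sum_congr rfl fun i _ => Block.finrank_ker_matAt (hs i),
    h.finrank_ker t] at h1
  have hle : ∀ i, (b i).horCount ≤
      Module.finrank ℂ (LinearMap.ker (Matrix.toLin' ((b i).matAt t))) := fun i => by
    by_cases hi : (b i).IsEigen t
    · exact (Block.horCount_lt_of_isEigen hi).le
    · exact (Block.finrank_ker_matAt hi).ge
  refine ⟨fun i hi => ?_, ?_⟩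
  · exact absurd (Finset.sum_lt_sum (fun i _ => hle i)
      ⟨i, Finset.mem_univ _, Block.horCount_lt_of_isEigen hi⟩) (not_lt.2 h1)
  · rw [h.finrank_ker t]
    exact le_antisymm h1 (Finset.sum_le_sum fun i _ => hle i)

/-- The sum is a polynomial in -t with infinitely many roots. It says that the vectors ((-t)^(n -
j))_j, t ∈ T, span the whole space. -/
theorem sum_pow_eq_zero_of_infinite {n : ℕ} {a : ℕ → ℂ} {T : Set ℂ} (hT : T.Infinite)
    (h : ∀ t ∈ T, ∑ j ∈ Finset.range (n + 1), (-t) ^ (n - j) * a j = 0) : ∀ j ≤ n, a j = 0 := by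
  let P : Polynomial ℂ := ∑ j ∈ Finset.range (n + 1), Polynomial.C (a (n - j)) * Polynomial.X ^ j
  have hP : P = 0 := by
    refine Polynomial.eq_zero_of_infinite_isRoot P ((hT.image neg_injective.injOn).mono ?_)
    rintro _ ⟨t, ht, rfl⟩
    simp only [Set.mem_ofPred_eq, Polynomial.IsRoot.def, P, Polynomial.eval_finsetSum,
      Polynomial.eval_mul, Polynomial.eval_C, Polynomial.eval_pow, Polynomial.eval_X]
    rw [← h t ht, ← Finset.sum_range_reflect]
    refine Finset.sum_congr rfl fun j hj => ?_
    rw [Finset.mem_range] at hj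
    rw [show n - (n + 1 - 1 - j) = j by omega, show n + 1 - 1 - j = n - j by omega, mul_comm]
  intro j hj
  have := congrArg (fun p => Polynomial.coeff p (n - j)) hP
  simp only [P, Polynomial.finsetSum_coeff, Polynomial.coeff_C_mul_X_pow,
    Polynomial.coeff_zero] at this
  rw [Finset.sum_eq_single (n - j)] at this
  · simpa [Nat.sub_sub_self hj] using this
  · intro i _ hi
    rw [if_neg hi.symm]
  · intro h'
    simp at h'

/-- The sum of the kernels over infinitely many parameters which are not eigenvalues is spanned by
the columns of the horizontal blocks. -/
theorem HasBlockForm.finrank_iSup_ker {ι : Type} [Fintype ι] {A B : U →ₗ[ℂ] W} {b : ι → Block}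
    (h : HasBlockForm A B b) {T : Set ℂ} (hT : T.Infinite)
    (hTe : ∀ t ∈ T, ∀ i, ¬ (b i).IsEigen t) :
    Module.finrank ℂ ↥(⨆ t ∈ T, LinearMap.ker (A + t • B)) = ∑ i, (b i).horCols := by
  classical
  obtain ⟨u, w, hA, hB⟩ := h
  let S := {p : Σ i, Fin (b i).cols // (b p.1).horCount = 1}
  have hS : (⨆ t ∈ T, LinearMap.ker (A + t • B)) =
      Submodule.span ℂ (Set.range fun p : S => u p) := by
    apply le_antisymm
    · refine iSup₂_le fun t ht v hv => ?_
      rw [mem_ker_iff_of_basis hA hB] at hv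
      rw [← u.sum_repr v]
      refine Submodule.sum_mem _ fun p _ => ?_
      by_cases hp : (b p.1).horCount = 1
      · exact Submodule.smul_mem _ _ (Submodule.subset_span ⟨⟨p, hp⟩, rfl⟩)
      · have h0 : (b p.1).horCount = 0 := by
          revert hp; rcases b p.1 with _ | _ | _ <;> simp [Block.horCount]
        have := congrFun (Block.matAt_injective h0 (hTe t ht p.1) (hv p.1)) p.2
        rw [Pi.zero_apply] at this
        rw [this, zero_smul]
        exact zero_mem _
    · rw [Submodule.span_le]
      rintro _ ⟨⟨⟨i, j⟩, hij⟩, rfl⟩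
      by_contra hmem
      -- A functional that vanishes on the sum of the kernels vanishes on infinitely many points of
      -- the curve of kernel vectors of the block, hence on every column of it.
      obtain ⟨φ, hφ, hle⟩ := Submodule.exists_le_ker_of_notMem hmem
      obtain ⟨ε, hε⟩ := Block.exists_eq_hor hij
      have hcols : (b i).cols = ε + 1 := by rw [hε]; rfl
      obtain ⟨a, ha⟩ := Block.exists_extension fun j => φ (u ⟨i, j⟩)
      have hzero := sum_pow_eq_zero_of_infinite (n := ε) (a := a) hT fun t ht => by
        have hv : (∑ j : Fin (b i).cols, (-t) ^ (ε - j : ℕ) • u ⟨i, j⟩) ∈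
            LinearMap.ker (A + t • B) := by
          rw [mem_ker_iff_of_basis hA hB]
          intro i'
          have hrepr : ∀ j', u.repr (∑ j : Fin (b i).cols, (-t) ^ (ε - j : ℕ) • u ⟨i, j⟩) ⟨i', j'⟩ =
              if i' = i then (-t) ^ (ε - j' : ℕ) else 0 := by
            intro j'
            rw [map_sum, Finsupp.finsetSum_apply]
            simp only [map_smul, Module.Basis.repr_self, Finsupp.smul_single, smul_eq_mul, mul_one]
            by_cases hi : i' = i
            · subst hi
              simp [Finsupp.single_apply]
            · rw [if_neg hi]
              refine Finset.sum_eq_zero fun j _ => Finsupp.single_eq_of_ne fun h => ?_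
              exact hi (congrArg Sigma.fst h)
          simp only [hrepr]
          by_cases hi : i' = i
          · subst hi
            simp only [if_true]
            exact Block.pow_mem_ker_matAt hε t
          · simp only [if_neg hi]
            exact zero_mem _
        have := hle (Submodule.mem_iSup_of_mem t (Submodule.mem_iSup_of_mem ht hv))
        rw [LinearMap.mem_ker, map_sum] at this
        rw [← hcols, ← this, ← Fin.sum_univ_eq_sum_range (fun j => (-t) ^ (ε - j) * a j)]
        refine Finset.sum_congr rfl fun j _ => ?_
        rw [map_smul, smul_eq_mul, ← congrFun ha j]
      refine hφ ?_
      have := congrFun ha j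
      rw [hzero j (by have := j.2; omega)] at this
      exact this
  rw [hS, finrank_span_eq_card (b := fun p : S => u p)
    (u.linearIndependent.comp _ Subtype.val_injective)]
  have e : S ≃ Σ i, {j : Fin (b i).cols // (b i).horCount = 1} :=
    { toFun := fun p => ⟨p.1.1, p.1.2, p.2⟩
      invFun := fun p => ⟨⟨p.1, p.2.1⟩, p.2.2⟩
      left_inv := fun _ => rfl
      right_inv := fun _ => rfl }
  rw [Fintype.card_congr e, Fintype.card_sigma]
  refine Finset.sum_congr rfl fun i _ => ?_
  rw [Block.horCols_eq]
  split_ifs with h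
  · rw [Fintype.card_congr (Equiv.subtypeUnivEquiv fun _ => h), Fintype.card_fin]
  · rw [Fintype.card_eq_zero_iff]
    exact ⟨fun p => h p.2⟩

end KernelSum

/-! ### Polynomial functions and semicontinuity -/

section PolyFun

/-- The algebra of polynomial functions on `E`. -/
noncomputable def polyFun (E : Type*) [AddCommGroup E] [Module ℂ E] : Subalgebra ℂ (E → ℂ) :=
  (MvPolynomial.aeval fun φ : Module.Dual ℂ E => (φ : E → ℂ)).range

variable {E : Type*} [AddCommGroup E] [Module ℂ E]

theorem aeval_dual_apply (q : MvPolynomial (Module.Dual ℂ E) ℂ) (y : E) :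
    MvPolynomial.aeval (fun φ : Module.Dual ℂ E => (φ : E → ℂ)) q y =
      MvPolynomial.eval (fun φ : Module.Dual ℂ E => φ y) q := by
  have : ((Pi.evalAlgHom ℂ (fun _ : E => ℂ) y).comp
      (MvPolynomial.aeval fun φ : Module.Dual ℂ E => (φ : E → ℂ))) =
      MvPolynomial.aeval (fun φ : Module.Dual ℂ E => φ y) := by
    ext φ; simp
  rw [← MvPolynomial.coe_aeval_eq_eval]
  exact DFunLike.congr_fun this q

theorem mem_polyFun {G : E → ℂ} : G ∈ polyFun E ↔ ∃ q : MvPolynomial (Module.Dual ℂ E) ℂ,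
    ∀ y, MvPolynomial.eval (fun φ : Module.Dual ℂ E => φ y) q = G y := by
  constructor
  · rintro ⟨q, rfl⟩
    exact ⟨q, fun y => (aeval_dual_apply q y).symm⟩
  · rintro ⟨q, hq⟩
    exact ⟨q, funext fun y => (aeval_dual_apply q y).trans (hq y)⟩

theorem dual_mem_polyFun (φ : Module.Dual ℂ E) : (fun y => φ y) ∈ polyFun E :=
  mem_polyFun.2 ⟨MvPolynomial.X φ, fun y => by simp⟩

theorem isZariskiOpen_of_polyFun {G : E → ℂ} (hG : G ∈ polyFun E) : IsZariskiOpen {y | G y ≠ 0} := by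
  obtain ⟨q, hq⟩ := mem_polyFun.1 hG
  exact ⟨{q}, by ext y; simp [hq]⟩

theorem IsZariskiOpen.exists_polyFun {S : Set E} (hS : IsZariskiOpen S) {y : E} (hy : y ∈ S) :
    ∃ G ∈ polyFun E, G y ≠ 0 ∧ ∀ z, G z ≠ 0 → z ∈ S := by
  obtain ⟨Q, rfl⟩ := hS
  obtain ⟨q, hq, hqy⟩ := hy
  exact ⟨_, mem_polyFun.2 ⟨q, fun _ => rfl⟩, hqy, fun z hz => ⟨q, hq, hz⟩⟩

theorem det_mem_polyFun {n : ℕ} {M : E → Matrix (Fin n) (Fin n) ℂ}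
    (h : ∀ i j, (fun z => M z i j) ∈ polyFun E) : (fun z => (M z).det) ∈ polyFun E := by
  have : (fun z => (M z).det) =
      ∑ σ : Equiv.Perm (Fin n), (Equiv.Perm.sign σ : ℤ) • ∏ i, fun z => M z (σ i) i := by
    ext z
    simp [Matrix.det_apply, Finset.sum_apply, Finset.prod_apply, Units.smul_def]
  rw [this]
  exact Subalgebra.sum_mem _ fun σ _ => zsmul_mem (Subalgebra.prod_mem _ fun i _ => h _ _) _

/-- The restriction of a polynomial function to a line is a polynomial. -/
theorem exists_polynomial_of_polyFun {G : E → ℂ} (hG : G ∈ polyFun E) (y v : E) :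
    ∃ P : Polynomial ℂ, ∀ t, P.eval t = G (y + t • v) := by
  obtain ⟨q, hq⟩ := mem_polyFun.1 hG
  refine ⟨MvPolynomial.aeval (fun φ : Module.Dual ℂ E =>
    Polynomial.C (φ y) + Polynomial.X * Polynomial.C (φ v)) q, fun t => ?_⟩
  rw [← hq]
  have : (Polynomial.aeval t).comp (MvPolynomial.aeval (fun φ : Module.Dual ℂ E =>
      Polynomial.C (φ y) + Polynomial.X * Polynomial.C (φ v))) =
      MvPolynomial.aeval (fun φ : Module.Dual ℂ E => φ (y + t • v)) := by
    ext φ; simp; ring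
  rw [← MvPolynomial.coe_aeval_eq_eval]
  simpa [Polynomial.coe_aeval_eq_eval] using DFunLike.congr_fun this q

/-- Irreducibility of the affine space, seen on the line through y and z: neither function vanishes
identically on it. -/
theorem exists_ne_zero_of_polyFun {G H : E → ℂ} (hG : G ∈ polyFun E) (hH : H ∈ polyFun E) {y z : E}
    (hy : G y ≠ 0) (hz : H z ≠ 0) : ∃ w, G w ≠ 0 ∧ H w ≠ 0 := by
  obtain ⟨P, hP⟩ := exists_polynomial_of_polyFun hG y (z - y)
  obtain ⟨Q, hQ⟩ := exists_polynomial_of_polyFun hH y (z - y)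
  have hP0 : P ≠ 0 := by
    rintro rfl
    exact hy (by simpa using (hP 0).symm)
  have hQ0 : Q ≠ 0 := by
    rintro rfl
    exact hz (by simpa using (hQ 1).symm)
  obtain ⟨t, ht⟩ := ((P * Q).roots.toFinset.finite_toSet).exists_notMem
  have : (P * Q).eval t ≠ 0 := fun h => ht (by simp [hP0, hQ0] at h ⊢; exact h)
  rw [Polynomial.eval_mul, hP, hQ] at this
  exact ⟨_, left_ne_zero_of_mul this, right_ne_zero_of_mul this⟩

/-- Lower semicontinuity of the rank. -/
theorem exists_polyFun_le_finrank_range {X Y : Type*} [AddCommGroup X] [Module ℂ X]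
    [AddCommGroup Y] [Module ℂ Y] [FiniteDimensional ℂ Y]
    (L : E → X →ₗ[ℂ] Y) (hL : ∀ x (ψ : Module.Dual ℂ Y), (fun z => ψ (L z x)) ∈ polyFun E)
    (z₀ : E) : ∃ G ∈ polyFun E, G z₀ ≠ 0 ∧ ∀ z, G z ≠ 0 →
      Module.finrank ℂ (LinearMap.range (L z₀)) ≤ Module.finrank ℂ (LinearMap.range (L z)) := by
  classical
  let b := Module.finBasis ℂ (LinearMap.range (L z₀))
  choose x hx using fun i => (b i).2
  obtain ⟨p, hp⟩ := LinearMap.exists_leftInverse_of_injective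
    (LinearMap.range (L z₀)).subtype (Submodule.ker_subtype _)
  -- The x_j are preimages of a basis of the range at z₀ and p is a projection onto that range. The
  -- matrix is the identity at z₀, and wherever its determinant is non-zero the vectors L_z x_j are
  -- independent.
  refine ⟨fun z => (Matrix.of fun i j => (b.coord i ∘ₗ p) (L z (x j))).det,
    det_mem_polyFun fun i j => hL (x j) (b.coord i ∘ₗ p), ?_, fun z hz => ?_⟩
  · have : (Matrix.of fun i j => (b.coord i ∘ₗ p) (L z₀ (x j))) = 1 := by
      ext i j
      have h1 : p (b j : Y) = b j := LinearMap.congr_fun hp (b j)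
      simp [hx, h1, Matrix.one_apply, Finsupp.single_apply, eq_comm]
    exact (congrArg Matrix.det this).trans_ne (by rw [Matrix.det_one]; exact one_ne_zero)
  · have hli : LinearIndependent ℂ fun j => (⟨L z (x j), x j, rfl⟩ : LinearMap.range (L z)) := by
      rw [Fintype.linearIndependent_iff]
      intro g hg
      have h0 : ∑ j, g j • L z (x j) = 0 := by
        simpa using congrArg (Submodule.subtype _) hg
      have := Matrix.eq_zero_of_mulVec_eq_zero hz (v := g) (by
        ext i
        have h1 := congrArg (b.coord i ∘ₗ p) h0
        rw [map_sum, map_zero] at h1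
        simp only [map_smul, smul_eq_mul] at h1
        simpa [Matrix.mulVec, dotProduct, mul_comm] using h1)
      exact fun i => congrFun this i
    simpa using hli.fintype_card_le_finrank

end PolyFun

/-! ### The dimension of a sum of kernels as a rank -/

section SumKer

variable {U W : Type*} [AddCommGroup U] [Module ℂ U] [AddCommGroup W] [Module ℂ W]

/-- The operator `(u i) ↦ ((f i (u i)), ∑ u i)`. -/
def stackMap {τ : Type*} [Fintype τ] (f : τ → U →ₗ[ℂ] W) : (τ → U) →ₗ[ℂ] (τ → W) × U :=
  (LinearMap.piMap f).prod (∑ i, LinearMap.proj i)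

theorem finrank_ker_piMap {τ : Type*} [Fintype τ] [FiniteDimensional ℂ U] (f : τ → U →ₗ[ℂ] W) :
    Module.finrank ℂ (LinearMap.ker (LinearMap.piMap f)) =
      ∑ i, Module.finrank ℂ (LinearMap.ker (f i)) := by
  rw [← Module.finrank_pi_fintype]
  exact LinearEquiv.finrank_eq
    { toFun := fun v i => ⟨v.1 i, congrFun v.2 i⟩
      map_add' := fun x y => rfl
      map_smul' := fun c x => rfl
      invFun := fun p => ⟨fun i => p i, funext fun i => (p i).2⟩
      left_inv := fun v => rfl
      right_inv := fun p => rfl }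

/-- The kernel consists of the tuples in ∏ ker f_i with zero sum, and summation maps ∏ ker f_i onto
Σ ker f_i; the rest is rank-nullity. Thus, as long as the ranks of the f_i are constant, dim Σ ker
f_i is lower semicontinuous, being a rank up to a constant. -/
theorem finrank_range_stackMap {τ : Type*} [Fintype τ] [FiniteDimensional ℂ U]
    [FiniteDimensional ℂ W] (f : τ → U →ₗ[ℂ] W) :
    Module.finrank ℂ (LinearMap.range (stackMap f)) =
      ∑ i, Module.finrank ℂ (LinearMap.range (f i)) +
        Module.finrank ℂ ↥(⨆ i, LinearMap.ker (f i)) := by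
  classical
  set K := LinearMap.ker (LinearMap.piMap f) with hK
  let σ : (τ → U) →ₗ[ℂ] U := ∑ i, LinearMap.proj i
  have hσ : ∀ u, σ u = ∑ i, u i := fun u => by simp [σ]
  have h1 : LinearMap.range (σ.domRestrict K) = ⨆ i, LinearMap.ker (f i) := by
    apply le_antisymm
    · rintro _ ⟨⟨u, hu⟩, rfl⟩
      rw [LinearMap.domRestrict_apply, hσ]
      exact Submodule.sum_mem _ fun i _ => Submodule.mem_iSup_of_mem i (congrFun hu i)
    · refine iSup_le fun i u hu => ⟨⟨Pi.single i u, ?_⟩, ?_⟩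
      · refine funext fun j => ?_
        by_cases hj : j = i
        · subst hj; simpa using hu
        · simp [hj]
      · simp [hσ]
  have h2 : (LinearMap.ker (σ.domRestrict K)).map K.subtype = LinearMap.ker (stackMap f) := by
    rw [stackMap, LinearMap.ker_prod, ← Submodule.map_comap_subtype]
    rfl
  have h3 := LinearMap.finrank_range_add_finrank_ker (σ.domRestrict K)
  rw [h1, ← Submodule.finrank_map_subtype_eq, h2, hK, finrank_ker_piMap] at h3
  have h4 := LinearMap.finrank_range_add_finrank_ker (stackMap f)
  rw [Module.finrank_pi_fintype,
    ← Finset.sum_congr rfl fun i _ => LinearMap.finrank_range_add_finrank_ker (f i),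
    Finset.sum_add_distrib] at h4
  omega

end SumKer

/-! ### Linear families of operators: the generic sum of kernels along a line -/

section Families

variable {E U W : Type*} [AddCommGroup E] [Module ℂ E] [AddCommGroup U] [Module ℂ U]
  [AddCommGroup W] [Module ℂ W]

/-- A point is regular for a linear family of operators if its kernel has the least dimension. -/
def RegularPoint (F : E →ₗ[ℂ] U →ₗ[ℂ] W) (y : E) : Prop :=
  ∀ z, Module.finrank ℂ (LinearMap.ker (F y)) ≤ Module.finrank ℂ (LinearMap.ker (F z))

/-- The sum of the kernels at the regular points of a line. -/
def kerSum (F : E →ₗ[ℂ] U →ₗ[ℂ] W) (x a : E) : Submodule ℂ U :=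
  ⨆ t ∈ {t : ℂ | RegularPoint F (x + t • a)}, LinearMap.ker (F (x + t • a))

theorem exists_regularPoint (F : E →ₗ[ℂ] U →ₗ[ℂ] W) : ∃ y, RegularPoint F y := by
  obtain ⟨y, -, hy⟩ := WellFounded.has_min (measure fun y =>
    Module.finrank ℂ (LinearMap.ker (F y))).wf Set.univ ⟨0, trivial⟩
  exact ⟨y, fun z => not_lt.1 (hy z trivial)⟩

theorem RegularPoint.of_finrank_range_le [FiniteDimensional ℂ U] {F : E →ₗ[ℂ] U →ₗ[ℂ] W} {x y : E}
    (hx : RegularPoint F x) (h : Module.finrank ℂ (LinearMap.range (F x)) ≤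
      Module.finrank ℂ (LinearMap.range (F y))) : RegularPoint F y := by
  intro z
  have h1 := LinearMap.finrank_range_add_finrank_ker (F x)
  have h2 := LinearMap.finrank_range_add_finrank_ker (F y)
  have := hx z
  omega

theorem RegularPoint.finrank_range_eq [FiniteDimensional ℂ U] {F : E →ₗ[ℂ] U →ₗ[ℂ] W} {x y : E}
    (hx : RegularPoint F x) (hy : RegularPoint F y) : Module.finrank ℂ (LinearMap.range (F x)) =
      Module.finrank ℂ (LinearMap.range (F y)) := by
  have h1 := LinearMap.finrank_range_add_finrank_ker (F x)
  have h2 := LinearMap.finrank_range_add_finrank_ker (F y)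
  have := hx y
  have := hy x
  omega

theorem apply_line_mem_polyFun (F : E →ₗ[ℂ] U →ₗ[ℂ] W) (t : ℂ) (u : U) (ψ : Module.Dual ℂ W) :
    (fun z : E × E => ψ (F (z.1 + t • z.2) u)) ∈ polyFun (E × E) := by
  have := dual_mem_polyFun (ψ ∘ₗ (F.flip u) ∘ₗ
    (LinearMap.fst ℂ E E + t • LinearMap.snd ℂ E E))
  simpa using this

theorem stackMap_mem_polyFun {τ : Type*} [Fintype τ] (F : E →ₗ[ℂ] U →ₗ[ℂ] W) (t : τ → ℂ)
    (u : τ → U) (ψ : Module.Dual ℂ ((τ → W) × U)) :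
    (fun z : E × E => ψ (stackMap (fun i => F (z.1 + t i • z.2)) u)) ∈ polyFun (E × E) := by
  classical
  let ψ' : τ → Module.Dual ℂ W := fun i =>
    ψ ∘ₗ LinearMap.inl ℂ _ _ ∘ₗ LinearMap.single ℂ (fun _ => W) i
  have h : (fun z : E × E => ψ (stackMap (fun i => F (z.1 + t i • z.2)) u)) =
      ∑ i, (fun z : E × E => ψ' i (F (z.1 + t i • z.2) (u i))) +
        algebraMap ℂ (E × E → ℂ) (ψ (0, ∑ i, u i)) := by
    ext z
    have h1 : stackMap (fun i => F (z.1 + t i • z.2)) u =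
        LinearMap.inl ℂ _ _ (∑ i, Pi.single i (F (z.1 + t i • z.2) (u i))) + (0, ∑ i, u i) := by
      rw [Finset.univ_sum_single]
      ext i
      · simp [stackMap]
      · simp [stackMap]
    rw [h1, map_add, map_sum, map_sum, Pi.add_apply, Finset.sum_apply]
    rfl
  rw [h]
  exact Subalgebra.add_mem _ (Subalgebra.sum_mem _ fun i _ => apply_line_mem_polyFun F _ _ _)
    (Subalgebra.algebraMap_mem _ _)

/-- In finite dimension finitely many parameters already give the whole sum, so that `stackMap` can
be used. -/
theorem exists_finite_kerSum_le [FiniteDimensional ℂ U] (F : E →ₗ[ℂ] U →ₗ[ℂ] W) (x a : E) :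
    ∃ (N : ℕ) (t : Fin N → ℂ), (∀ i, RegularPoint F (x + t i • a)) ∧
      kerSum F x a ≤ ⨆ i, LinearMap.ker (F (x + t i • a)) := by
  let T := {t : ℂ | RegularPoint F (x + t • a)}
  have hcomp : IsCompactElement (kerSum F x a) :=
    (Submodule.fg_iff_compact _).1 (IsNoetherian.noetherian _)
  obtain ⟨s, hs⟩ := CompleteLattice.IsCompactElement.exists_finset_of_le_iSup _ hcomp
    (fun t : T => LinearMap.ker (F (x + (t : ℂ) • a))) (by rw [kerSum, iSup_subtype'])
  obtain ⟨N, ⟨e⟩⟩ := Finite.exists_equiv_fin s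
  refine ⟨N, fun i => ((e.symm i : T) : ℂ), fun i => (e.symm i : T).2, hs.trans ?_⟩
  refine iSup₂_le fun t ht => ?_
  refine le_iSup_of_le (e ⟨t, ht⟩) ?_
  simp only [e.symm_apply_apply, le_refl]

theorem exists_polyFun_regularPoint [FiniteDimensional ℂ U] [FiniteDimensional ℂ W]
    (F : E →ₗ[ℂ] U →ₗ[ℂ] W) (t : ℂ) {y₀ c₀ : E} (h : RegularPoint F (y₀ + t • c₀)) :
    ∃ H ∈ polyFun (E × E), H (y₀, c₀) ≠ 0 ∧ ∀ y c, H (y, c) ≠ 0 → RegularPoint F (y + t • c) := by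
  obtain ⟨H, hH, hH0, hHz⟩ := exists_polyFun_le_finrank_range
    (fun z : E × E => F (z.1 + t • z.2)) (apply_line_mem_polyFun F t) (y₀, c₀)
  exact ⟨H, hH, hH0, fun y c hyc => h.of_finrank_range_le (hHz (y, c) hyc)⟩

/-- Take K to be the maximum over regular points, attained at (y₀, c₀) by finitely many parameters
t_i. On a Zariski open set around this pair the points y + t_i c stay regular, so the ranks of the
operators are unchanged, and the rank of the stacked map does not drop; hence the sum of kernels
keeps dimension at least K, and K is its maximum. -/
theorem exists_generic_kerSum [FiniteDimensional ℂ U] [FiniteDimensional ℂ W]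
    (F : E →ₗ[ℂ] U →ₗ[ℂ] W) :
    ∃ K : ℕ, (∃ G ∈ polyFun (E × E), (∃ z, G z ≠ 0) ∧ ∀ y c, G (y, c) ≠ 0 →
        RegularPoint F y ∧ Module.finrank ℂ (kerSum F y c) = K) ∧
      ∀ x a, RegularPoint F x → Module.finrank ℂ (kerSum F x a) ≤ K := by
  classical
  obtain ⟨y₁, hy₁⟩ := exists_regularPoint F
  let p : ℕ → Prop := fun k => ∃ y c, RegularPoint F y ∧ Module.finrank ℂ (kerSum F y c) = k
  have hp : ∃ k ≤ Module.finrank ℂ U, p k := ⟨_, Submodule.finrank_le _, y₁, 0, hy₁, rfl⟩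
  obtain ⟨k₁, hk₁, hpk₁⟩ := hp
  obtain ⟨y₀, c₀, hy₀, hK⟩ := Nat.findGreatest_spec hk₁ hpk₁
  have hmax : ∀ x a, RegularPoint F x → Module.finrank ℂ (kerSum F x a) ≤
      Nat.findGreatest p (Module.finrank ℂ U) := fun x a hx =>
    Nat.le_findGreatest (Submodule.finrank_le _) ⟨x, a, hx, rfl⟩
  refine ⟨_, ?_, hmax⟩
  generalize Nat.findGreatest p (Module.finrank ℂ U) = K at *
  obtain ⟨N, t, ht, hs⟩ := exists_finite_kerSum_le F y₀ c₀
  obtain ⟨G, hG, hG0, hGz⟩ := exists_polyFun_le_finrank_range _ (stackMap_mem_polyFun F t) (y₀, c₀)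
  obtain ⟨H₀, hH₀, hH₀0, hH₀z⟩ := exists_polyFun_regularPoint F 0 (y₀ := y₀) (c₀ := c₀)
    (by simpa using hy₀)
  choose H hH hH0 hHz using fun i => exists_polyFun_regularPoint F (t i) (ht i)
  refine ⟨G * (H₀ * ∏ i, H i), Subalgebra.mul_mem _ hG (Subalgebra.mul_mem _ hH₀
    (Subalgebra.prod_mem _ fun i _ => hH i)), ⟨(y₀, c₀), ?_⟩, fun y c hyc => ?_⟩
  · simp only [Pi.mul_apply, Finset.prod_apply]
    exact mul_ne_zero hG0 (mul_ne_zero hH₀0 (Finset.prod_ne_zero_iff.2 fun i _ => hH0 i))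
  · simp only [Pi.mul_apply, Finset.prod_apply] at hyc
    have h1 := left_ne_zero_of_mul hyc
    have h2 := left_ne_zero_of_mul (right_ne_zero_of_mul hyc)
    have h3 := Finset.prod_ne_zero_iff.1 (right_ne_zero_of_mul (right_ne_zero_of_mul hyc))
    have hy : RegularPoint F y := by simpa using hH₀z y c h2
    have hreg := fun i => hHz i y c (h3 i (Finset.mem_univ _))
    refine ⟨hy, le_antisymm (hmax y c hy) ?_⟩
    have h4 := hGz _ h1
    rw [finrank_range_stackMap, finrank_range_stackMap,
      Finset.sum_congr rfl fun i _ => (ht i).finrank_range_eq (hreg i)] at h4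
    have h5 := Nat.le_of_add_le_add_left h4
    have h7 : (⨆ i, LinearMap.ker (F (y + t i • c))) ≤ kerSum F y c :=
      iSup_le fun i => le_iSup₂_of_le (t i) (hreg i) le_rfl
    rw [← hK]
    exact (Submodule.finrank_mono hs).trans (h5.trans (Submodule.finrank_mono h7))

end Families

/-! ### Indices of a pencil through a regular point -/

namespace Block

/-- The size of a Jordan block, and `0` for a Kronecker block. -/
def jordanSize : Block → ℕ
  | jordan _ n => n + 1
  | _ => 0

theorem horCols_add_horCols_dual_add_jordanSize (b : Block) :
    b.horCols + b.dual.horCols + b.jordanSize = b.rows + b.horCount := by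
  rcases b with _ | _ | _ <;> simp [horCols, dual, jordanSize, rows, horCount]

theorem jordanSize_relabel (σ : Equiv.Perm (OnePoint ℂ)) (b : Block) :
    (b.relabel σ).jordanSize = b.jordanSize := by
  rcases b with _ | _ | _ <;> rfl

end Block

section Families

variable {E U W : Type*} [AddCommGroup E] [Module ℂ E] [AddCommGroup U] [Module ℂ U]
  [AddCommGroup W] [Module ℂ W]

theorem RegularPoint.finrank_ker_le {F : E →ₗ[ℂ] U →ₗ[ℂ] W} {x : E} (hx : RegularPoint F x)
    (a : E) (s : ℂ) : Module.finrank ℂ (LinearMap.ker (F x + (0 : ℂ) • F a)) ≤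
      Module.finrank ℂ (LinearMap.ker (F x + s • F a)) := by
  have := hx (x + s • a)
  have hzero : F x + (0 : ℂ) • F a = F x := by rw [zero_smul, add_zero]
  rw [hzero]
  rwa [map_add, map_smul] at this

/-- As the minimum over the whole family is attained on the line, at t = 0, the parameters of
regular points are exactly the non-eigenvalues, an infinite set. -/
theorem RegularPoint.finrank_kerSum {ι : Type} [Fintype ι] {F : E →ₗ[ℂ] U →ₗ[ℂ] W} {x a : E}
    (hx : RegularPoint F x) {b : ι → Block} (h : HasBlockForm (F x) (F a) b) :
    Module.finrank ℂ (kerSum F x a) = ∑ i, (b i).horCols := by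
  obtain ⟨-, h2⟩ := h.finrank_ker_of_min (hx.finrank_ker_le a)
  have hline : ∀ t : ℂ, F (x + t • a) = F x + t • F a := fun t => by rw [map_add, map_smul]
  have hzero : F x + (0 : ℂ) • F a = F x := by rw [zero_smul, add_zero]
  rw [hzero] at h2
  have hT : {t : ℂ | RegularPoint F (x + t • a)}.Infinite := by
    refine (finite_setOf_isEigen b).infinite_compl.mono fun t ht => ?_
    have ht : ∀ i, ¬ (b i).IsEigen t := fun i hi => ht ⟨i, hi⟩
    have h3 : Module.finrank ℂ (LinearMap.ker (F (x + t • a))) ≤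
        Module.finrank ℂ (LinearMap.ker (F x)) := by
      rw [hline, h.finrank_ker t, h2]
      exact (Finset.sum_congr rfl fun i _ => Block.finrank_ker_matAt (ht i)).le
    exact fun z => h3.trans (hx z)
  have hTe : ∀ t ∈ {t : ℂ | RegularPoint F (x + t • a)}, ∀ i, ¬ (b i).IsEigen t := by
    intro t ht
    refine (h.finrank_ker_of_min (t := t) fun s => ?_).1
    have := ht (x + s • a)
    rwa [hline, hline] at this
  have hsum : kerSum F x a =
      ⨆ t ∈ {t : ℂ | RegularPoint F (x + t • a)}, LinearMap.ker (F x + t • F a) :=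
    iSup_congr fun t => by rw [hline]
  rw [hsum]
  exact h.finrank_iSup_ker hT hTe

/-- Since every canonical form gives the same kernel sum, the infimum is over a singleton;
uniqueness of the canonical form itself is not needed. -/
theorem RegularPoint.kHorPencil_eq [FiniteDimensional ℂ U] [FiniteDimensional ℂ W]
    {F : E →ₗ[ℂ] U →ₗ[ℂ] W} {x : E} (hx : RegularPoint F x) (a : E) :
    kHorPencil (F x) (F a) = Module.finrank ℂ (kerSum F x a) := by
  obtain ⟨N, b, hb⟩ := exists_hasCanonicalForm (F x) (F a)
  have : {k | ∃ (N : ℕ) (b : Fin N → Block), HasCanonicalForm (F x) (F a) b ∧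
      ∑ i, (b i).horCols = k} = {Module.finrank ℂ (kerSum F x a)} := by
    ext k
    constructor
    · rintro ⟨N, b, hb, rfl⟩
      exact (hx.finrank_kerSum (hasCanonicalForm_iff.1 hb)).symm
    · rintro rfl
      exact ⟨N, b, hb, (hx.finrank_kerSum (hasCanonicalForm_iff.1 hb)).symm⟩
  rw [kHorPencil, this, csInf_singleton]

/-- The family of transposed operators. -/
def dualFamily (F : E →ₗ[ℂ] U →ₗ[ℂ] W) : E →ₗ[ℂ] Module.Dual ℂ W →ₗ[ℂ] Module.Dual ℂ U :=
  Module.Dual.transpose ∘ₗ F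

theorem finrank_ker_dualMap [FiniteDimensional ℂ U] [FiniteDimensional ℂ W] (A : U →ₗ[ℂ] W) :
    Module.finrank ℂ (LinearMap.ker A.dualMap) + Module.finrank ℂ U =
      Module.finrank ℂ W + Module.finrank ℂ (LinearMap.ker A) := by
  have h1 := LinearMap.finrank_range_add_finrank_ker A
  have h2 := LinearMap.finrank_range_add_finrank_ker A.dualMap
  rw [LinearMap.finrank_range_dualMap_eq_finrank_range, Subspace.dual_finrank_eq] at h2
  omega

theorem regularPoint_dualFamily_iff [FiniteDimensional ℂ U] [FiniteDimensional ℂ W]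
    {F : E →ₗ[ℂ] U →ₗ[ℂ] W} {x : E} : RegularPoint (dualFamily F) x ↔ RegularPoint F x := by
  refine forall_congr' fun z => ?_
  have h1 := finrank_ker_dualMap (F x)
  have h2 := finrank_ker_dualMap (F z)
  change Module.finrank ℂ (LinearMap.ker (F x).dualMap) ≤
    Module.finrank ℂ (LinearMap.ker (F z).dualMap) ↔ _
  omega

/-- The count k_hor + k_vert + J = dim W + dim ker F_x, block by block; k_vert is the kernel sum of
the transposed family, whose horizontal blocks are the vertical ones of the original. -/
theorem RegularPoint.finrank_kerSum_add [FiniteDimensional ℂ U] [FiniteDimensional ℂ W]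
    {ι : Type} [Fintype ι] {F : E →ₗ[ℂ] U →ₗ[ℂ] W} {x a : E}
    (hx : RegularPoint F x) {b : ι → Block} (h : HasBlockForm (F x) (F a) b) :
    Module.finrank ℂ (kerSum F x a) + Module.finrank ℂ (kerSum (dualFamily F) x a) +
      ∑ i, (b i).jordanSize = Module.finrank ℂ W + Module.finrank ℂ (LinearMap.ker (F x)) := by
  have h1 := hx.finrank_kerSum h
  have h2 := (regularPoint_dualFamily_iff.2 hx).finrank_kerSum (a := a) h.dualMap
  have h3 := (h.finrank_ker_of_min (hx.finrank_ker_le a)).2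
  rw [zero_smul, add_zero] at h3
  have h4 : Module.finrank ℂ W = ∑ i, (b i).rows := by
    obtain ⟨-, w, -⟩ := h
    rw [Module.finrank_eq_card_basis w]
    simp
  rw [h1, h2, h3, h4, ← Finset.sum_add_distrib, ← Finset.sum_add_distrib, ← Finset.sum_add_distrib]
  exact Finset.sum_congr rfl fun i _ => (b i).horCols_add_horCols_dual_add_jordanSize

theorem RegularPoint.not_isEigen_zero {ι : Type} [Fintype ι] {F : E →ₗ[ℂ] U →ₗ[ℂ] W} {x a : E}
    (hx : RegularPoint F x) {b : ι → Block} (h : HasBlockForm (F x) (F a) b) (i : ι) :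
    ¬ (b i).IsEigen 0 :=
  (h.finrank_ker_of_min (hx.finrank_ker_le a)).1 i

end Families

/-! ### Determinantal ideals -/

section Minors

variable {R : Type*} [CommRing R] {k m n : ℕ}

/-- Half of Cauchy–Binet: multilinearity in the rows expands the determinant over choices r of rows
of M. Choices with a repetition give 0; the others are increasing ones up to sign. -/
theorem det_mul_mem_of_rows (I : Ideal R) (M : Matrix (Fin n) (Fin k) R)
    (h : ∀ s : Fin k ↪o Fin n, (M.submatrix s id).det ∈ I) (P : Matrix (Fin k) (Fin n) R) :
    (P * M).det ∈ I := by
  have hall : ∀ r : Fin k → Fin n, (M.submatrix r id).det ∈ I := by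
    intro r
    by_cases hr : Function.Injective r
    · let σ := Tuple.sort r
      have hmono : StrictMono (r ∘ σ) :=
        (Tuple.monotone_sort r).strictMono_of_injective (hr.comp σ.injective)
      have h1 := h (OrderEmbedding.ofStrictMono _ hmono)
      have h2 := Matrix.det_permute σ (M.submatrix r id)
      rw [Matrix.submatrix_submatrix] at h2
      have h3 : (M.submatrix (r ∘ σ) id).det ∈ I := h1
      have h4 : (M.submatrix r id).det = (Equiv.Perm.sign σ : ℤ) * (M.submatrix (r ∘ σ) id).det := by
        have h5 : ((Equiv.Perm.sign σ : ℤ) : R) * (Equiv.Perm.sign σ : ℤ) = 1 := by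
          rw [← Int.cast_mul, ← Units.val_mul, Int.units_mul_self]; simp
        change _ = _ * (M.submatrix (r ∘ σ) (id ∘ id)).det
        rw [h2, ← mul_assoc, h5, one_mul]
      rw [h4]
      exact I.mul_mem_left _ h3
    · rw [Function.not_injective_iff] at hr
      obtain ⟨i, j, hij, hne⟩ := hr
      rw [Matrix.det_zero_of_row_eq hne (by ext; simp [hij])]
      exact zero_mem _
  have hrow : (P * M).det =
      Matrix.detRowAlternating.toMultilinearMap fun i => ∑ j, P i j • M j := by
    refine congrArg Matrix.det (Matrix.ext fun i j => ?_)
    simp [Matrix.mul_apply, Finset.sum_apply]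
  rw [hrow, MultilinearMap.map_sum]
  refine Ideal.sum_mem _ fun r _ => ?_
  rw [MultilinearMap.map_smul_univ]
  exact I.mul_mem_left _ (hall r)

theorem det_mul_mul_mem (I : Ideal R) (M : Matrix (Fin n) (Fin m) R)
    (h : ∀ (s : Fin k ↪o Fin n) (t : Fin k ↪o Fin m), (M.submatrix s t).det ∈ I)
    (P : Matrix (Fin k) (Fin n) R) (Q : Matrix (Fin m) (Fin k) R) : (P * M * Q).det ∈ I := by
  rw [Matrix.mul_assoc]
  refine det_mul_mem_of_rows I _ (fun s => ?_) P
  rw [← Matrix.det_transpose]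
  have : ((M * Q).submatrix s id).transpose = Q.transpose * (M.submatrix s id).transpose := by
    rw [← Matrix.transpose_mul]
    rfl
  rw [this]
  refine det_mul_mem_of_rows I _ (fun t => ?_) _
  rw [← Matrix.det_transpose]
  exact h s t

/-- `M` factors through the square matrix `D` by a split injection and a split surjection. -/
def IsSplitFactor {α β κ : Type} [Fintype α] [Fintype β] [Fintype κ] [DecidableEq κ]
    (M : Matrix α β R) (D : Matrix κ κ R) : Prop :=
  ∃ (L : Matrix α κ R) (N : Matrix κ β R) (P : Matrix κ α R) (Q : Matrix β κ R),
    M = L * D * N ∧ P * L = 1 ∧ N * Q = 1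

theorem IsSplitFactor.det_dvd {M : Matrix (Fin n) (Fin m) R} {D : Matrix (Fin k) (Fin k) R}
    (h : IsSplitFactor M D) (s : Fin k → Fin n) (t : Fin k → Fin m) :
    D.det ∣ (M.submatrix s t).det := by
  obtain ⟨L, N, -, -, rfl, -, -⟩ := h
  have : (L * D * N).submatrix s t = L.submatrix s id * D * N.submatrix id t := rfl
  rw [this, Matrix.det_mul, Matrix.det_mul]
  exact Dvd.dvd.mul_right (Dvd.intro_left _ rfl) _

/-- The one-sided inverses recover D = P M Q. With `IsSplitFactor.det_dvd` this makes det D a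
generator of the ideal of k × k minors of M. -/
theorem IsSplitFactor.det_mem {M : Matrix (Fin n) (Fin m) R} {D : Matrix (Fin k) (Fin k) R}
    (h : IsSplitFactor M D) (I : Ideal R)
    (hI : ∀ (s : Fin k ↪o Fin n) (t : Fin k ↪o Fin m), (M.submatrix s t).det ∈ I) : D.det ∈ I := by
  obtain ⟨L, N, P, Q, rfl, hP, hQ⟩ := h
  have h1 := det_mul_mul_mem I _ hI P Q
  have h2 : P * (L * D * N) * Q = D := by
    calc P * (L * D * N) * Q = (P * L) * D * (N * Q) := by simp only [Matrix.mul_assoc]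
      _ = D := by rw [hP, hQ, Matrix.one_mul, Matrix.mul_one]
  rwa [h2] at h1

theorem IsSplitFactor.mul_mul {α β α' β' κ : Type} [Fintype α] [Fintype β] [Fintype κ]
    [DecidableEq κ] [Fintype α'] [Fintype β'] [DecidableEq α] [DecidableEq β]
    {M : Matrix α β R} {D : Matrix κ κ R} (h : IsSplitFactor M D) {A : Matrix α' α R}
    {A' : Matrix α α' R} {B : Matrix β β' R} {B' : Matrix β' β R} (hA : A' * A = 1)
    (hB : B * B' = 1) : IsSplitFactor (A * M * B) D := by
  obtain ⟨L, N, P, Q, rfl, hP, hQ⟩ := h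
  refine ⟨A * L, N * B, P * A', B' * Q, by simp only [Matrix.mul_assoc], ?_, ?_⟩
  · calc P * A' * (A * L) = P * (A' * A) * L := by simp only [Matrix.mul_assoc]
      _ = 1 := by rw [hA, Matrix.mul_one, hP]
  · calc N * B * (B' * Q) = N * (B * B') * Q := by simp only [Matrix.mul_assoc]
      _ = 1 := by rw [hB, Matrix.mul_one, hQ]

theorem IsSplitFactor.reindex {α β κ κ' : Type} [Fintype α] [Fintype β] [Fintype κ]
    [DecidableEq κ] [Fintype κ'] [DecidableEq κ'] {M : Matrix α β R} {D : Matrix κ κ R}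
    (h : IsSplitFactor M D) (e : κ' ≃ κ) : IsSplitFactor M (D.submatrix e e) := by
  obtain ⟨L, N, P, Q, rfl, hP, hQ⟩ := h
  refine ⟨L.submatrix id e, N.submatrix e id, P.submatrix e id, Q.submatrix id e, ?_, ?_, ?_⟩
  · rw [Matrix.submatrix_mul_equiv, Matrix.submatrix_mul_equiv, Matrix.submatrix_id_id]
  · rw [← Matrix.submatrix_mul _ _ _ id _ Function.bijective_id, hP, Matrix.submatrix_one_equiv]
  · rw [← Matrix.submatrix_mul _ _ _ id _ Function.bijective_id, hQ, Matrix.submatrix_one_equiv]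

theorem IsSplitFactor.transpose {α β κ : Type} [Fintype α] [Fintype β] [Fintype κ]
    [DecidableEq κ] {M : Matrix α β R} {D : Matrix κ κ R} (h : IsSplitFactor M D) :
    IsSplitFactor M.transpose D.transpose := by
  obtain ⟨L, N, P, Q, rfl, hP, hQ⟩ := h
  refine ⟨N.transpose, L.transpose, Q.transpose, P.transpose, ?_, ?_, ?_⟩
  · rw [Matrix.transpose_mul, Matrix.transpose_mul, Matrix.mul_assoc]
  · rw [← Matrix.transpose_mul, hQ, Matrix.transpose_one]
  · rw [← Matrix.transpose_mul, hP, Matrix.transpose_one]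

theorem IsSplitFactor.blockDiagonal' {ι : Type} [Fintype ι] [DecidableEq ι] {α β κ : ι → Type}
    [∀ i, Fintype (α i)] [∀ i, Fintype (β i)] [∀ i, Fintype (κ i)] [∀ i, DecidableEq (κ i)]
    {M : ∀ i, Matrix (α i) (β i) R} {D : ∀ i, Matrix (κ i) (κ i) R}
    (h : ∀ i, IsSplitFactor (M i) (D i)) :
    IsSplitFactor (Matrix.blockDiagonal' M) (Matrix.blockDiagonal' D) := by
  choose L N P Q h1 h2 h3 using h
  refine ⟨Matrix.blockDiagonal' L, Matrix.blockDiagonal' N, Matrix.blockDiagonal' P,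
    Matrix.blockDiagonal' Q, ?_, ?_, ?_⟩
  · rw [← Matrix.blockDiagonal'_mul, ← Matrix.blockDiagonal'_mul]
    exact congrArg _ (funext h1)
  · rw [← Matrix.blockDiagonal'_mul, funext h2]
    exact Matrix.blockDiagonal'_one
  · rw [← Matrix.blockDiagonal'_mul, funext h3]
    exact Matrix.blockDiagonal'_one

theorem det_blockDiagonal' {ι : Type} [Fintype ι] [DecidableEq ι] {κ : ι → Type}
    [∀ i, Fintype (κ i)] [∀ i, DecidableEq (κ i)] (D : ∀ i, Matrix (κ i) (κ i) R) :
    (Matrix.blockDiagonal' D).det = ∏ i, (D i).det := by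
  classical
  let e : ι ≃ Fin (Fintype.card ι) := Fintype.equivFin ι
  have htri : (Matrix.blockDiagonal' D).BlockTriangular fun p => e p.1 := by
    rintro ⟨i, p⟩ ⟨j, q⟩ h
    refine Matrix.blockDiagonal'_apply_ne _ _ _ ?_
    rintro rfl
    exact lt_irrefl _ h
  rw [htri.det_fintype, ← Equiv.prod_comp e]
  refine Finset.prod_congr rfl fun i _ => ?_
  let g : κ i ≃ {p : Σ i, κ i // e p.1 = e i} :=
    { toFun := fun p => ⟨⟨i, p⟩, rfl⟩
      invFun := fun p => e.injective p.2 ▸ p.1.2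
      left_inv := fun p => rfl
      right_inv := by
        rintro ⟨⟨j, p⟩, h⟩
        obtain rfl := e.injective h
        rfl }
  rw [← Matrix.det_submatrix_equiv_self g]
  congr 1
  ext p q
  simp [g, Matrix.toSquareBlock_def, Matrix.blockDiagonal'_apply_eq]

end Minors

/-! ### Polynomial matrices of pencils -/

namespace Block

open Polynomial in
/-- The polynomial matrix `B + X A` of a block. -/
noncomputable def polyMat (b : Block) : Matrix (Fin b.rows) (Fin b.cols) ℂ[X] :=
  b.matB.map Polynomial.C + (Polynomial.X : ℂ[X]) • b.matA.map Polynomial.C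

open Polynomial in
-- Without its first column the matrix B + XA is lower triangular with ones on the diagonal, so it
-- has a right inverse over ℂ[X]: Kronecker blocks contribute only the factor 1.
theorem isSplitFactor_hor (ε : ℕ) :
    IsSplitFactor (hor ε).polyMat (1 : Matrix (Fin ε) (Fin ε) ℂ[X]) := by
  suffices h : ∀ N : Matrix (Fin ε) (Fin (ε + 1)) ℂ[X], (∀ i j, N i j =
      C (if (i : ℕ) + 1 = j then 1 else 0) + X * C (if (i : ℕ) = j then 1 else 0)) →
      IsSplitFactor N (1 : Matrix (Fin ε) (Fin ε) ℂ[X]) from h (hor ε).polyMat fun _ _ => rfl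
  intro N hN
  have hdet : (N.submatrix id Fin.succ).det = 1 := by
    rw [Matrix.det_of_isLowerTriangular]
    · simp [hN]
    · intro i j hij
      have hij : (i : ℕ) < j := hij
      rw [Matrix.submatrix_apply, hN, Fin.val_succ, id, if_neg (by omega), if_neg (by omega)]
      simp
  have h1 : N * (1 : Matrix (Fin (ε + 1)) (Fin (ε + 1)) ℂ[X]).submatrix id Fin.succ =
      N.submatrix id Fin.succ := by
    ext i j
    simp [Matrix.mul_apply, Matrix.one_apply]
  refine ⟨1, N, 1, (1 : Matrix (Fin (ε + 1)) (Fin (ε + 1)) ℂ[X]).submatrix id Fin.succ *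
    (N.submatrix id Fin.succ)⁻¹, ?_, ?_, ?_⟩
  · rw [Matrix.one_mul, Matrix.one_mul]
  · rw [Matrix.one_mul]
  · rw [← Matrix.mul_assoc, h1, Matrix.mul_nonsing_inv _ (by rw [hdet]; exact isUnit_one)]

open Polynomial in
theorem isSplitFactor_vert (η : ℕ) :
    IsSplitFactor (vert η).polyMat (1 : Matrix (Fin η) (Fin η) ℂ[X]) := by
  have h := (isSplitFactor_hor η).transpose
  rw [Matrix.transpose_one] at h
  have : (vert η).polyMat = (hor η).polyMat.transpose := by
    refine Matrix.ext fun i j => ?_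
    change C (if (i : ℕ) = j + 1 then (1 : ℂ) else 0) + X * C (if (i : ℕ) = j then (1 : ℂ) else 0) =
      C (if (j : ℕ) + 1 = i then (1 : ℂ) else 0) + X * C (if (j : ℕ) = i then (1 : ℂ) else 0)
    simp only [eq_comm]
  rw [this]
  exact h

theorem isSplitFactor_self {R : Type*} [CommRing R] {κ : Type} [Fintype κ] [DecidableEq κ]
    (D : Matrix κ κ R) : IsSplitFactor D D :=
  ⟨1, 1, 1, 1, by rw [Matrix.one_mul, Matrix.mul_one], Matrix.one_mul _, Matrix.one_mul _⟩

open Polynomial in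
-- A Jordan block of size n + 1 has determinant X^(n+1) at infinity and (zX + 1)^(n+1) for
-- eigenvalue z. The degree is full because z ≠ 0.
theorem exists_isSplitFactor (b : Block) (hb : ¬ b.IsEigen 0) :
    ∃ (c : ℕ) (D : Matrix (Fin c) (Fin c) ℂ[X]), c + b.horCount = b.cols ∧
      IsSplitFactor b.polyMat D ∧ D.det ≠ 0 ∧ D.det.natDegree = b.jordanSize := by
  rcases b with ⟨_ | z, n⟩ | ε | η
  · let D : Matrix (Fin (n + 1)) (Fin (n + 1)) ℂ[X] := (jordan OnePoint.infty n).polyMat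
    have hD : ∀ i j, D i j = C (if (i : ℕ) + 1 = j then 1 else 0) +
      X * C (if (i : ℕ) = j then 1 else 0) := fun _ _ => rfl
    have hdet : D.det = X ^ (n + 1) := by
      rw [Matrix.det_of_isUpperTriangular]
      · simp [hD]
      · intro i j hij
        have hij : (j : ℕ) < i := hij
        rw [hD, if_neg (by omega), if_neg (by omega)]
        simp
    refine ⟨n + 1, D, rfl, isSplitFactor_self D, ?_, ?_⟩
    · rw [hdet]; exact pow_ne_zero _ X_ne_zero
    · rw [hdet, natDegree_X_pow]; rfl
  · let D : Matrix (Fin (n + 1)) (Fin (n + 1)) ℂ[X] := (jordan (OnePoint.some z) n).polyMat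
    have hD : ∀ i j, D i j = C (if (i : ℕ) = j then 1 else 0) +
      X * C (if (i : ℕ) = j then z else if (i : ℕ) + 1 = j then 1 else 0) := fun _ _ => rfl
    have hz : z ≠ 0 := fun h => hb (by rw [h]; exact congrArg OnePoint.some neg_zero.symm)
    have hdet : D.det = (C z * X + C 1) ^ (n + 1) := by
      rw [Matrix.det_of_isUpperTriangular]
      · simp [hD]; ring
      · intro i j hij
        have hij : (j : ℕ) < i := hij
        rw [hD, if_neg (by omega), if_neg (by omega), if_neg (by omega)]
        simp
    have hdeg : (C z * X + C 1 : ℂ[X]).natDegree = 1 := natDegree_linear hz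
    refine ⟨n + 1, D, rfl, isSplitFactor_self D, ?_, ?_⟩
    · rw [hdet]
      refine pow_ne_zero _ fun h => ?_
      rw [h, natDegree_zero] at hdeg
      exact zero_ne_one hdeg
    · rw [hdet, natDegree_pow, hdeg, mul_one]; rfl
  · exact ⟨ε, 1, rfl, isSplitFactor_hor ε, by simp, by simp [jordanSize]⟩
  · exact ⟨η, 1, rfl, isSplitFactor_vert η, by simp, by simp [jordanSize]⟩

end Block

/-! ### The generator of the ideal of maximal non-zero minors of a pencil -/

section PencilMatrix

variable {E U W : Type*} [AddCommGroup E] [Module ℂ E] [AddCommGroup U] [Module ℂ U]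
  [AddCommGroup W] [Module ℂ W]

open Polynomial in
/-- The polynomial matrix of the pencil `B + X A`. -/
noncomputable def pencilMatrix {m n : ℕ} (e : Module.Basis (Fin m) ℂ U)
    (f : Module.Basis (Fin n) ℂ W) (A B : U →ₗ[ℂ] W) : Matrix (Fin n) (Fin m) ℂ[X] :=
  (LinearMap.toMatrix e f B).map Polynomial.C +
    (Polynomial.X : ℂ[X]) • (LinearMap.toMatrix e f A).map Polynomial.C

open Polynomial in
theorem RegularPoint.exists_isSplitFactor {m n N : ℕ} (e : Module.Basis (Fin m) ℂ U)
    (f : Module.Basis (Fin n) ℂ W) {F : E →ₗ[ℂ] U →ₗ[ℂ] W} {x a : E}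
    (hx : RegularPoint F x) {b : Fin N → Block} (h : HasCanonicalForm (F x) (F a) b) {r : ℕ}
    (hr : r + Module.finrank ℂ (LinearMap.ker (F x)) = m) :
    ∃ D : Matrix (Fin r) (Fin r) ℂ[X], IsSplitFactor (pencilMatrix e f (F x) (F a)) D ∧
      D.det ≠ 0 ∧ D.det.natDegree = ∑ i, (b i).jordanSize := by
  have hbf := hasCanonicalForm_iff.1 h
  have hker := (hbf.finrank_ker_of_min (hx.finrank_ker_le a)).2
  rw [zero_smul, add_zero] at hker
  choose c D hc hD hD0 hDdeg using fun i =>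
    (b i).exists_isSplitFactor (hx.not_isEigen_zero hbf i)
  obtain ⟨u, w, hA, hB⟩ := h
  have hm : m = ∑ i, (b i).cols := by
    have h1 := Module.finrank_eq_card_basis e
    rw [Module.finrank_eq_card_basis u] at h1
    simpa using h1.symm
  have hcard : Fintype.card (Fin r) = Fintype.card (Σ i, Fin (c i)) := by
    rw [Fintype.card_sigma, Fintype.card_fin]
    simp only [Fintype.card_fin]
    have : ∑ i, (b i).cols = ∑ i, c i + ∑ i, (b i).horCount := by
      rw [← Finset.sum_add_distrib]
      exact Finset.sum_congr rfl fun i _ => (hc i).symm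
    omega
  have hblock : (Matrix.blockDiagonal' fun i => (b i).matB).map C +
      (X : ℂ[X]) • (Matrix.blockDiagonal' fun i => (b i).matA).map C =
      Matrix.blockDiagonal' fun i => (b i).polyMat := by
    rw [Matrix.blockDiagonal'_map _ _ C_0, Matrix.blockDiagonal'_map _ _ C_0,
      ← Matrix.blockDiagonal'_smul, ← Matrix.blockDiagonal'_add]
    rfl
  have hchange : ∀ G : U →ₗ[ℂ] W, (LinearMap.toMatrix e f G).map C =
      (f.toMatrix w).map C * (LinearMap.toMatrix u w G).map C * (u.toMatrix e).map (C : ℂ →+* ℂ[X]) := by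
    intro G
    rw [← basis_toMatrix_mul_linearMap_toMatrix_mul_basis_toMatrix e u f w, Matrix.map_mul,
      Matrix.map_mul]
  have hM : pencilMatrix e f (F x) (F a) = (f.toMatrix w).map C *
      (Matrix.blockDiagonal' fun i => (b i).polyMat) * (u.toMatrix e).map (C : ℂ →+* ℂ[X]) := by
    rw [pencilMatrix, hchange, hchange, hA, hB, ← hblock, Matrix.mul_add, Matrix.add_mul,
      Matrix.mul_smul, Matrix.smul_mul]
  have hsplit : IsSplitFactor (pencilMatrix e f (F x) (F a)) (Matrix.blockDiagonal' D) := by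
    rw [hM]
    refine (IsSplitFactor.blockDiagonal' hD).mul_mul (A' := (w.toMatrix f).map C)
      (B' := (e.toMatrix u).map C) ?_ ?_
    · rw [← Matrix.map_mul, Module.Basis.toMatrix_mul_toMatrix_flip]
      exact Matrix.map_one _ C_0 C_1
    · rw [← Matrix.map_mul, Module.Basis.toMatrix_mul_toMatrix_flip]
      exact Matrix.map_one _ C_0 C_1
  refine ⟨_, hsplit.reindex (Fintype.equivOfCardEq hcard), ?_, ?_⟩
  · rw [Matrix.det_submatrix_equiv_self, det_blockDiagonal']
    exact Finset.prod_ne_zero_iff.2 fun i _ => hD0 i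
  · rw [Matrix.det_submatrix_equiv_self, det_blockDiagonal',
      natDegree_prod _ _ fun i _ => hD0 i]
    exact Finset.sum_congr rfl fun i _ => hDdeg i

end PencilMatrix

/-! ### Coprime polynomials along lines -/

section Lines

open Polynomial

attribute [local instance] Polynomial.algebra Polynomial.isLocalization

/-- In the ring of polynomials over a factorial domain, an ideal which meets the constants only
in zero has a common prime factor. -/
theorem exists_prime_dvd_of_disjoint {S : Type*} [CommRing S] [IsDomain S]
    [UniqueFactorizationMonoid S] {I : Ideal S[X]} (hI : I ≠ ⊥)
    (hdisj : ∀ g : S, Polynomial.C g ∈ I → g = 0) : ∃ π : S[X], Prime π ∧ ∀ f ∈ I, π ∣ f := by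
  let K := FractionRing S
  let M : Submonoid S[X] := (nonZeroDivisors S).map (Polynomial.C : S →+* S[X])
  have hM : ∀ P : Ideal S[X], (∀ g : S, Polynomial.C g ∈ P → g = 0) →
      Disjoint (M : Set S[X]) (P : Set S[X]) := by
    intro P hP
    rw [Set.disjoint_left]
    rintro _ ⟨g, hg, rfl⟩ hgP
    exact nonZeroDivisors.ne_zero hg (hP g hgP)
  -- Enlarge I to a prime P that still misses the non-zero constants, and pick a prime element π in
  -- P. In the principal ideal domain K[X] the non-zero prime generated by π is maximal, so (π) and
  -- P have the same extension; contracting back gives P = (π).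
  obtain ⟨P, hPprime, hIP, hPd⟩ := Ideal.exists_le_prime_disjoint I M (hM I hdisj).symm
  obtain ⟨π, hπP, hπ⟩ := hPprime.exists_mem_prime_of_ne_bot (fun h => hI (le_bot_iff.1 (h ▸ hIP)))
  refine ⟨π, hπ, fun f hf => ?_⟩
  have hle : Ideal.span {π} ≤ P := (Ideal.span_singleton_le_iff_mem _).2 hπP
  have hQprime : (Ideal.span {π}).IsPrime := (Ideal.span_singleton_prime hπ.ne_zero).2 hπ
  have hQd : Disjoint (M : Set S[X]) (Ideal.span {π} : Set S[X]) := hPd.symm.mono_right hle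
  have : IsLocalization M K[X] := Polynomial.isLocalization _ _
  have h1 : ((Ideal.span {π}).map (algebraMap S[X] K[X])).IsPrime :=
    IsLocalization.isPrime_of_isPrime_disjoint M K[X] _ hQprime hQd
  have h2 : (P.map (algebraMap S[X] K[X])).IsPrime :=
    IsLocalization.isPrime_of_isPrime_disjoint M K[X] _ hPprime hPd.symm
  have h3 := IsLocalization.under_map_of_isPrime_disjoint M K[X] hQprime hQd
  have h4 := IsLocalization.under_map_of_isPrime_disjoint M K[X] hPprime hPd.symm
  have h5 : (Ideal.span {π}).map (algebraMap S[X] K[X]) ≠ ⊥ := by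
    intro h
    rw [Ideal.map_span, Set.image_singleton, Ideal.span_singleton_eq_bot] at h
    have h6 : algebraMap S[X] K[X] π = π.map (algebraMap S K) := rfl
    rw [h6, Polynomial.map_eq_zero_iff (IsFractionRing.injective S K)] at h
    exact hπ.ne_zero h
  have h6 := (h1.isMaximal h5).eq_of_le h2.ne_top (Ideal.map_mono hle)
  have h7 : f ∈ Ideal.span {π} := by
    rw [← h3, h6, h4]
    exact hIP hf
  exact Ideal.mem_span_singleton.1 h7

variable {n : ℕ}

/-- The substitution `y ↦ y + X v` of polynomials on `ℂⁿ`. -/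
noncomputable def lineHom (v : Fin n → ℂ) :
    MvPolynomial (Fin n) ℂ →ₐ[ℂ] (MvPolynomial (Fin n) ℂ)[X] :=
  MvPolynomial.aeval fun k => Polynomial.C (MvPolynomial.X k) +
    Polynomial.X * Polynomial.C (MvPolynomial.C (v k))

/-- The substitution `(y, X) ↦ (y + X v, X)`. -/
noncomputable def shearHom (v : Fin n → ℂ) :
    (MvPolynomial (Fin n) ℂ)[X] →+* (MvPolynomial (Fin n) ℂ)[X] :=
  Polynomial.eval₂RingHom (lineHom v).toRingHom Polynomial.X

theorem shearHom_C (v : Fin n → ℂ) (q : MvPolynomial (Fin n) ℂ) :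
    shearHom v (Polynomial.C q) = lineHom v q := by
  simp [shearHom]

theorem shearHom_shearHom_neg (v : Fin n → ℂ) (q : (MvPolynomial (Fin n) ℂ)[X]) :
    shearHom v (shearHom (-v) q) = q := by
  have : (shearHom v).comp (shearHom (-v)) = RingHom.id _ := by
    refine Polynomial.ringHom_ext' (MvPolynomial.ringHom_ext' ?_ fun k => ?_) ?_
    · ext z
      simp [shearHom, lineHom]
    · simp [shearHom, lineHom]
      ring
    · simp [shearHom]
  exact DFunLike.congr_fun this q

theorem eval_lineHom (v c : Fin n → ℂ) (t : ℂ) (q : MvPolynomial (Fin n) ℂ) :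
    (lineHom v q).eval₂ (MvPolynomial.eval c) t = MvPolynomial.eval (c + t • v) q := by
  have : ((Polynomial.eval₂RingHom (MvPolynomial.eval c) t).comp (lineHom v).toRingHom) =
      MvPolynomial.eval (c + t • v) := by
    refine MvPolynomial.ringHom_ext' ?_ fun k => ?_
    · ext z
      simp [lineHom]
    · simp [lineHom]
      ring
  exact DFunLike.congr_fun this q

/-- A generic line in a given direction avoids the common zeros of coprime polynomials. -/
theorem exists_generic_line {ι : Type*} {h : ι → MvPolynomial (Fin n) ℂ}
    (hcop : ∀ d, (∀ i, d ∣ h i) → IsUnit d) (v : Fin n → ℂ) :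
    ∃ g : MvPolynomial (Fin n) ℂ, g ≠ 0 ∧ ∀ c, MvPolynomial.eval c g ≠ 0 →
      ∀ t : ℂ, ∃ i, MvPolynomial.eval (c + t • v) (h i) ≠ 0 := by
  obtain ⟨I, hIdef⟩ : ∃ I : Ideal (MvPolynomial (Fin n) ℂ)[X],
    I = Ideal.span (Set.range fun i => lineHom v (h i)) := ⟨_, rfl⟩
  have hmem : ∀ i, lineHom v (h i) ∈ I := fun i => hIdef ▸ Ideal.subset_span ⟨i, rfl⟩
  -- Such a g is a combination of the h_i(y + Xv), so a common zero on the line through c forces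
  -- g(c) = 0. If there were none, all h_i(y + Xv) would share a prime factor, and undoing the shear
  -- would give a non-unit dividing all the h_i.
  obtain ⟨g, hgI, hg0⟩ : ∃ g, Polynomial.C g ∈ I ∧ g ≠ 0 := by
    by_contra! hno
    obtain ⟨i₀, hi₀⟩ : ∃ i, h i ≠ 0 := by
      by_contra! h0
      exact not_isUnit_zero (hcop 0 fun i => by rw [h0 i])
    have hback : ∀ q, shearHom (-v) (lineHom v q) = Polynomial.C q := fun q => by
      have := shearHom_shearHom_neg (-v) (Polynomial.C q)
      rwa [neg_neg, shearHom_C] at this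
    have hI : I ≠ ⊥ := by
      intro hbot
      have h1 := hmem i₀
      rw [hbot, Ideal.mem_bot] at h1
      have h2 := hback (h i₀)
      rw [h1, map_zero] at h2
      exact hi₀ (Polynomial.C_eq_zero.1 h2.symm)
    obtain ⟨π, hπ, hdvd⟩ := exists_prime_dvd_of_disjoint hI hno
    have hd : ∀ i, shearHom (-v) π ∣ Polynomial.C (h i) := fun i => by
      have := map_dvd (shearHom (-v)) (hdvd _ (hmem i))
      rwa [hback] at this
    -- A divisor of a non-zero polynomial constant in X is itself constant in X, hence a common
    -- divisor of the h_i in the coefficient ring.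
    have hdeg : (shearHom (-v) π).natDegree = 0 := by
      have := Polynomial.natDegree_le_of_dvd (hd i₀) (Polynomial.C_ne_zero.2 hi₀)
      rw [Polynomial.natDegree_C] at this
      omega
    obtain ⟨d, hdC⟩ := Polynomial.natDegree_eq_zero.1 hdeg
    have hunit : IsUnit (shearHom (-v) π) := by
      rw [← hdC]
      refine (hcop d fun i => ?_).map Polynomial.C
      have := hd i
      rw [← hdC, Polynomial.C_dvd_iff_dvd_coeff] at this
      simpa using this 0
    refine hπ.not_isUnit ?_
    rw [← shearHom_shearHom_neg v π]
    exact hunit.map _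
  refine ⟨g, hg0, fun c hc t => ?_⟩
  by_contra! hzero
  have hle : I ≤ RingHom.ker (Polynomial.eval₂RingHom (MvPolynomial.eval c) t) := by
    rw [hIdef, Ideal.span_le]
    rintro _ ⟨i, rfl⟩
    exact (eval_lineHom v c t (h i)).trans (hzero i)
  have := hle hgI
  rw [RingHom.mem_ker, Polynomial.coe_eval₂RingHom, Polynomial.eval₂_C] at this
  exact hc this

end Lines

/-! ### Restriction of the minors to lines -/

section LinePoly

open Polynomial

variable {n : ℕ}

/-- The restriction of a polynomial to the line `u + X v`. -/
noncomputable def linePoly (u v : Fin n → ℂ) : MvPolynomial (Fin n) ℂ →ₐ[ℂ] ℂ[X] :=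
  MvPolynomial.aeval fun k => C (u k) + X * C (v k)

theorem eval_linePoly (u v : Fin n → ℂ) (q : MvPolynomial (Fin n) ℂ) (t : ℂ) :
    (linePoly u v q).eval t = MvPolynomial.eval (u + t • v) q := by
  have : ((Polynomial.aeval t).comp (linePoly u v)) = MvPolynomial.aeval (u + t • v) := by
    ext k
    simp [linePoly]
    ring
  rw [← MvPolynomial.coe_aeval_eq_eval]
  simpa [Polynomial.coe_aeval_eq_eval] using DFunLike.congr_fun this q

theorem natDegree_linePoly_le (u v : Fin n → ℂ) (q : MvPolynomial (Fin n) ℂ) :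
    (linePoly u v q).natDegree ≤ q.totalDegree := by
  have := MvPolynomial.aeval_natDegree_le q le_rfl (fun k => C (u k) + X * C (v k)) (n := 1)
    fun k => by
      rw [add_comm, mul_comm]
      exact natDegree_linear_le
  simpa [linePoly] using this

theorem span_eq_top_of_no_common_root {ι : Type*} {h : ι → ℂ[X]}
    (hr : ∀ t, ∃ i, (h i).eval t ≠ 0) : Ideal.span (Set.range h) = ⊤ := by
  obtain ⟨d, hd⟩ := (IsPrincipalIdealRing.principal (Ideal.span (Set.range h))).principal
  have hdvd : ∀ i, d ∣ h i := fun i => Ideal.mem_span_singleton.1 <| by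
    rw [← Ideal.submodule_span_eq, ← hd]
    exact Ideal.subset_span ⟨i, rfl⟩
  rw [hd, Ideal.submodule_span_eq, Ideal.span_singleton_eq_top]
  by_contra hu
  obtain ⟨t, ht⟩ : ∃ t, d.IsRoot t := by
    by_cases h0 : d = 0
    · exact ⟨0, by simp [h0]⟩
    · refine IsAlgClosed.exists_root d fun hdeg => hu ?_
      exact Polynomial.isUnit_iff_degree_eq_zero.2 hdeg
  obtain ⟨i, hi⟩ := hr t
  exact hi (ht.dvd (hdvd i))

/-- The degree of a greatest common divisor `J` of the multiples `l * h i` of `l`. -/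
theorem natDegree_gcd_of_multiples {ι : Type*} {h : ι → ℂ[X]} {l J : ℂ[X]} (hJ0 : J ≠ 0)
    (hdvd : ∀ i, J ∣ l * h i) (hJ : J ∈ Ideal.span (Set.range fun i => l * h i)) :
    l.natDegree ≤ J.natDegree ∧
      (J.natDegree = l.natDegree ↔ ∀ t, ∃ i, (h i).eval t ≠ 0) := by
  have hspan : Ideal.span (Set.range fun i => l * h i) =
      Ideal.span {l} * Ideal.span (Set.range h) := by
    rw [Ideal.span_mul_span', Set.singleton_mul, ← Set.range_comp]
    rfl
  rw [hspan] at hJ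
  -- Write J = l g with g in the ideal of the h_i. Equality of degrees means that g is a non-zero
  -- constant, that is, that the h_i generate the unit ideal.
  obtain ⟨g, hg, rfl⟩ := Ideal.mem_span_singleton_mul.1 hJ
  have hl0 := left_ne_zero_of_mul hJ0
  have hg0 := right_ne_zero_of_mul hJ0
  rw [natDegree_mul hl0 hg0]
  refine ⟨Nat.le_add_right _ _, fun hdeg t => ?_, fun hr => ?_⟩
  · by_contra! hall
    have hle : Ideal.span (Set.range h) ≤ RingHom.ker (Polynomial.evalRingHom t) := by
      rw [Ideal.span_le]
      rintro _ ⟨i, rfl⟩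
      exact hall i
    have h1 : g.eval t = 0 := hle hg
    obtain ⟨c, rfl⟩ := natDegree_eq_zero.1 (by omega : g.natDegree = 0)
    rw [eval_C] at h1
    exact hg0 (by rw [h1, C_0])
  · have h1 : l ∈ Ideal.span {l} * Ideal.span (Set.range h) := by
      rw [span_eq_top_of_no_common_root hr, Ideal.mul_top]
      exact Ideal.mem_span_singleton_self l
    rw [← hspan] at h1
    have hle : Ideal.span (Set.range fun i => l * h i) ≤ Ideal.span {l * g} := by
      rw [Ideal.span_le]
      rintro _ ⟨i, rfl⟩
      exact Ideal.mem_span_singleton.2 (hdvd i)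
    have h2 := natDegree_le_of_dvd (Ideal.mem_span_singleton.1 (hle h1)) hl0
    rw [natDegree_mul hl0 hg0] at h2
    omega

end LinePoly

section UFD

/-- Greatest common divisors of finite families exist in a factorial domain. -/
theorem exists_gcd_family {A ι : Type*} [CommRing A] [IsDomain A] [UniqueFactorizationMonoid A]
    [Finite ι] (q : ι → A) : ∃ p, (∀ i, p ∣ q i) ∧ ∀ d, (∀ i, d ∣ q i) → d ∣ p := by
  classical
  have := Fintype.ofFinite ι
  let := UniqueFactorizationMonoid.toGCDMonoid A
  suffices h : ∀ s : Finset ι, ∃ p, (∀ i ∈ s, p ∣ q i) ∧ ∀ d, (∀ i ∈ s, d ∣ q i) → d ∣ p by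
    obtain ⟨p, h1, h2⟩ := h Finset.univ
    exact ⟨p, fun i => h1 i (Finset.mem_univ _), fun d hd => h2 d fun i _ => hd i⟩
  intro s
  induction s using Finset.induction_on with
  | empty => exact ⟨0, by simp, by simp⟩
  | insert i s _ ih =>
    obtain ⟨p, h1, h2⟩ := ih
    refine ⟨gcd (q i) p, fun j hj => ?_, fun d hd => dvd_gcd (hd i (Finset.mem_insert_self _ _))
      (h2 d fun j hj => hd j (Finset.mem_insert_of_mem hj))⟩
    rcases Finset.mem_insert.1 hj with rfl | hj
    · exact gcd_dvd_left _ _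
    · exact (gcd_dvd_right _ _).trans (h1 j hj)

end UFD

/-! ### Minors of the operators of a representation, restricted to a line -/

section Representations

variable {𝔤 V : Type*} [LieRing 𝔤] [LieAlgebra ℂ 𝔤] [AddCommGroup V] [Module ℂ V]
  (ρ : 𝔤 →ₗ⁅ℂ⁆ Module.End ℂ V)

/-- The operators `R_x` as a linear family. -/
def linearFamily : V →ₗ[ℂ] 𝔤 →ₗ[ℂ] V :=
  (ρ : 𝔤 →ₗ[ℂ] Module.End ℂ V).flip

theorem stabiliserSum_eq_kerSum (x a : V) :
    stabiliserSum ρ x a = kerSum (linearFamily ρ) x a := rfl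

variable {ρ}

theorem IsRegular.regRank_add_finrank_ker [FiniteDimensional ℂ 𝔤] {x : V} (hx : IsRegular ρ x) :
    regRank ρ + Module.finrank ℂ (LinearMap.ker (R ρ x)) = Module.finrank ℂ 𝔤 := by
  have h : regRank ρ = Module.finrank ℂ (LinearMap.range (R ρ x)) := by
    have hle : ∀ y, Module.finrank ℂ (LinearMap.range (R ρ y)) ≤
        Module.finrank ℂ (LinearMap.range (R ρ x)) := fun y => by
      have h1 := LinearMap.finrank_range_add_finrank_ker (R ρ x)
      have h2 := LinearMap.finrank_range_add_finrank_ker (R ρ y)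
      have h3 : Module.finrank ℂ (LinearMap.ker (R ρ x)) ≤
        Module.finrank ℂ (LinearMap.ker (R ρ y)) := hx y
      omega
    refine le_antisymm (ciSup_le hle) (le_ciSup (f := fun y =>
      Module.finrank ℂ (LinearMap.range (R ρ y))) ⟨_, Set.forall_mem_range.2 hle⟩ x)
  rw [h, LinearMap.finrank_range_add_finrank_ker]

section Minors

open Polynomial

variable {m n : ℕ} (e : Module.Basis (Fin m) ℂ 𝔤) (f : Module.Basis (Fin n) ℂ V)

/-- The line is a + Xx, with the parameter on the regular point x, which is why `pencilMatrix` is B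
+ XA; in this form the leading coefficients are governed by x. -/
theorem linePoly_minor (x a : V) (s : Fin (regRank ρ) ↪o Fin n) (t : Fin (regRank ρ) ↪o Fin m) :
    linePoly (f.repr a) (f.repr x) (minor ρ e f s t) =
      ((pencilMatrix e f (linearFamily ρ x) (linearFamily ρ a)).submatrix s t).det := by
  have hrepr : ∀ (y : V) i j, f.repr (linearFamily ρ y (e j)) i =
      ∑ k, f.repr (ρ (e j) (f k)) i * f.repr y k := by
    intro y i j
    have h1 : linearFamily ρ y (e j) = ∑ k, f.repr y k • ρ (e j) (f k) := by
      change ρ (e j) y = _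
      conv_lhs => rw [← f.sum_repr y]
      rw [map_sum]
      exact Finset.sum_congr rfl fun k _ => map_smul _ _ _
    rw [h1, map_sum, Finsupp.finsetSum_apply]
    refine Finset.sum_congr rfl fun k _ => ?_
    rw [map_smul, Finsupp.smul_apply, smul_eq_mul, mul_comm]
  rw [minor, AlgHom.map_det]
  congr 1
  refine Matrix.ext fun i j => ?_
  simp only [AlgHom.mapMatrix_apply, Matrix.map_apply, Matrix.submatrix_apply, polyMatrix,
    Matrix.of_apply, pencilMatrix, Matrix.add_apply, Matrix.smul_apply, LinearMap.toMatrix_apply,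
    hrepr, map_sum, map_mul, smul_eq_mul, Finset.mul_sum]
  rw [← Finset.sum_add_distrib]
  refine Finset.sum_congr rfl fun k _ => ?_
  simp [linePoly]
  ring

theorem totalDegree_minor_le (s : Fin (regRank ρ) ↪o Fin n) (t : Fin (regRank ρ) ↪o Fin m) :
    (minor ρ e f s t).totalDegree ≤ regRank ρ := by
  have hentry : ∀ i j, (polyMatrix ρ e f i j).totalDegree ≤ 1 := fun i j => by
    rw [polyMatrix, Matrix.of_apply]
    refine MvPolynomial.totalDegree_finsetSum_le fun k _ => ?_
    refine (MvPolynomial.totalDegree_mul _ _).trans ?_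
    rw [MvPolynomial.totalDegree_C, MvPolynomial.totalDegree_X]
  rw [minor, Matrix.det_apply]
  refine MvPolynomial.totalDegree_finsetSum_le fun σ _ => ?_
  rw [Units.smul_def, zsmul_eq_mul]
  refine (MvPolynomial.totalDegree_mul _ _).trans ?_
  rw [← map_intCast (MvPolynomial.C : ℂ →+* MvPolynomial (Fin n) ℂ), MvPolynomial.totalDegree_C,
    zero_add]
  refine (MvPolynomial.totalDegree_finsetProd _ _).trans ?_
  refine (Finset.sum_le_sum fun i _ => hentry _ _).trans ?_
  simp

variable [FiniteDimensional ℂ 𝔤] {x : V}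

theorem IsRegular.exists_isSplitFactor (hx : IsRegular ρ x) {a : V} {N : ℕ} {b : Fin N → Block}
    (h : HasCanonicalForm (R ρ x) (R ρ a) b) :
    ∃ D : Matrix (Fin (regRank ρ)) (Fin (regRank ρ)) ℂ[X],
      IsSplitFactor (pencilMatrix e f (linearFamily ρ x) (linearFamily ρ a)) D ∧
      D.det ≠ 0 ∧ D.det.natDegree = ∑ i, (b i).jordanSize := by
  refine RegularPoint.exists_isSplitFactor e f (F := linearFamily ρ) hx h ?_
  have := hx.regRank_add_finrank_ker
  rw [Module.finrank_eq_card_basis e, Fintype.card_fin] at this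
  exact this

/-- Take a = 0: the minors of X R_x generate a non-zero ideal, so some r × r minor of R_x is
non-zero. -/
theorem IsRegular.exists_det_submatrix_ne_zero (hx : IsRegular ρ x) :
    ∃ (s : Fin (regRank ρ) ↪o Fin n) (t : Fin (regRank ρ) ↪o Fin m),
      ((LinearMap.toMatrix e f (linearFamily ρ x)).submatrix s t).det ≠ 0 := by
  have := Module.Finite.of_basis f
  obtain ⟨N, b, hb⟩ := exists_hasCanonicalForm (R ρ x) (R ρ 0)
  obtain ⟨D, hD, hD0, -⟩ := hx.exists_isSplitFactor e f hb
  by_contra! hall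
  refine hD0 (hD.det_mem ⊥ fun s t => ?_)
  have h1 : (pencilMatrix e f (linearFamily ρ x) (linearFamily ρ 0)).submatrix s t =
      (X : ℂ[X]) • ((LinearMap.toMatrix e f (linearFamily ρ x)).submatrix s t).map C := by
    rw [pencilMatrix, map_zero, map_zero, Matrix.map_zero _ C_0, zero_add]
    rfl
  rw [h1, Matrix.det_smul, ← RingHom.mapMatrix_apply, ← RingHom.map_det, hall, map_zero, mul_zero]
  exact Submodule.zero_mem _

/-- A minor has degree at most r, and the coefficient of X^r on the line a + Xx is its value at x,
non-zero for a suitable minor. -/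
theorem IsRegular.exists_natDegree_linePoly_minor (hx : IsRegular ρ x) (a : V) :
    ∃ (s : Fin (regRank ρ) ↪o Fin n) (t : Fin (regRank ρ) ↪o Fin m),
      linePoly (f.repr a) (f.repr x) (minor ρ e f s t) ≠ 0 ∧
      (linePoly (f.repr a) (f.repr x) (minor ρ e f s t)).natDegree =
        (minor ρ e f s t).totalDegree := by
  obtain ⟨s, t, hst⟩ := hx.exists_det_submatrix_ne_zero e f
  have hcoeff : (linePoly (f.repr a) (f.repr x) (minor ρ e f s t)).coeff (regRank ρ) ≠ 0 := by
    have h1 : (pencilMatrix e f (linearFamily ρ x) (linearFamily ρ a)).submatrix s t =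
        (X : ℂ[X]) • ((LinearMap.toMatrix e f (linearFamily ρ x)).submatrix s t).map C +
        ((LinearMap.toMatrix e f (linearFamily ρ a)).submatrix s t).map C :=
      add_comm _ _
    have h2 := coeff_det_X_add_C_card ((LinearMap.toMatrix e f (linearFamily ρ x)).submatrix s t)
      ((LinearMap.toMatrix e f (linearFamily ρ a)).submatrix s t)
    rw [Fintype.card_fin, ← h1, ← linePoly_minor] at h2
    rwa [h2]
  refine ⟨s, t, fun h0 => hcoeff (by rw [h0, coeff_zero]), le_antisymm
    (natDegree_linePoly_le _ _ _) ((totalDegree_minor_le e f s t).trans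
    (le_natDegree_of_ne_zero hcoeff))⟩

variable {e f} {p : MvPolynomial (Fin n) ℂ}
  {h : (Fin (regRank ρ) ↪o Fin n) → (Fin (regRank ρ) ↪o Fin m) → MvPolynomial (Fin n) ℂ}

/-- Degrees add up in a product and cannot grow under restriction. Since some minor p h keeps its
degree, so does its factor p. -/
theorem IsRegular.natDegree_linePoly (hx : IsRegular ρ x) (a : V)
    (hp : ∀ s t, minor ρ e f s t = p * h s t) :
    (linePoly (f.repr a) (f.repr x) p).natDegree = p.totalDegree := by
  obtain ⟨s, t, h0, hdeg⟩ := hx.exists_natDegree_linePoly_minor e f a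
  have hm0 : minor ρ e f s t ≠ 0 := fun h => h0 (by rw [h, map_zero])
  rw [hp] at h0 hdeg hm0
  rw [map_mul] at h0 hdeg
  rw [natDegree_mul (left_ne_zero_of_mul h0) (right_ne_zero_of_mul h0),
    MvPolynomial.totalDegree_mul_of_isDomain (left_ne_zero_of_mul hm0)
    (right_ne_zero_of_mul hm0)] at hdeg
  have h1 := natDegree_linePoly_le (f.repr a) (f.repr x) p
  have h2 := natDegree_linePoly_le (f.repr a) (f.repr x) (h s t)
  omega

/-- The total size of the Jordan blocks of the pencil `R_x + t R_a` is at least the degree of a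
common factor `p` of the minors, and it is equal to it if and only if the complementary factors
have no common zero on the line `a + t x`. -/
theorem IsRegular.totalDegree_le_sum_jordanSize (hx : IsRegular ρ x) {a : V} {N : ℕ}
    {b : Fin N → Block} (hb : HasCanonicalForm (R ρ x) (R ρ a) b)
    (hp : ∀ s t, minor ρ e f s t = p * h s t) :
    p.totalDegree ≤ ∑ i, (b i).jordanSize ∧
      (∑ i, (b i).jordanSize = p.totalDegree ↔
        ∀ z : ℂ, ∃ s t, MvPolynomial.eval (f.repr (a + z • x)) (h s t) ≠ 0) := by
  obtain ⟨D, hD, hD0, hDdeg⟩ := hx.exists_isSplitFactor e f hb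
  have hprod : ∀ s t, linePoly (f.repr a) (f.repr x) p * linePoly (f.repr a) (f.repr x) (h s t) =
      ((pencilMatrix e f (linearFamily ρ x) (linearFamily ρ a)).submatrix s t).det := fun s t => by
    rw [← map_mul, ← hp, linePoly_minor]
  have key := natDegree_gcd_of_multiples (l := linePoly (f.repr a) (f.repr x) p)
    (h := fun st : (Fin (regRank ρ) ↪o Fin n) × (Fin (regRank ρ) ↪o Fin m) =>
      linePoly (f.repr a) (f.repr x) (h st.1 st.2)) hD0
    (fun st => by rw [hprod]; exact hD.det_dvd _ _)
    (hD.det_mem _ fun s t => Ideal.subset_span ⟨(s, t), hprod s t⟩)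
  rw [hx.natDegree_linePoly a hp, hDdeg] at key
  refine ⟨key.1, key.2.trans (forall_congr' fun z => ?_)⟩
  simp only [Prod.exists, eval_linePoly, map_add, map_smul]
  rfl

end Minors

end Representations

/-! ### Generic pairs -/

section PolyFun

variable {E : Type*} [AddCommGroup E] [Module ℂ E]

theorem polyFun_prodMk {G : E × E → ℂ} (hG : G ∈ polyFun (E × E)) (x : E) :
    (fun c => G (x, c)) ∈ polyFun E := by
  obtain ⟨q, hq⟩ := mem_polyFun.1 hG
  refine mem_polyFun.2 ⟨MvPolynomial.aeval (fun φ : Module.Dual ℂ (E × E) =>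
    MvPolynomial.C (φ (x, 0)) + MvPolynomial.X (φ ∘ₗ LinearMap.inr ℂ E E)) q, fun c => ?_⟩
  rw [← hq]
  have : (MvPolynomial.aeval fun φ : Module.Dual ℂ E => φ c).comp
      (MvPolynomial.aeval (fun φ : Module.Dual ℂ (E × E) =>
        MvPolynomial.C (φ (x, 0)) + MvPolynomial.X (φ ∘ₗ LinearMap.inr ℂ E E))) =
      MvPolynomial.aeval (fun φ : Module.Dual ℂ (E × E) => φ (x, c)) := by
    ext φ
    have : (x, c) = (x, (0 : E)) + (0, c) := by simp
    rw [MvPolynomial.aeval_X, this, map_add]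
    simp
  rw [← MvPolynomial.coe_aeval_eq_eval, ← MvPolynomial.coe_aeval_eq_eval]
  exact DFunLike.congr_fun this q

theorem eval_repr_mem_polyFun {n : ℕ} (f : Module.Basis (Fin n) ℂ E) (g : MvPolynomial (Fin n) ℂ) :
    (fun c => MvPolynomial.eval (f.repr c) g) ∈ polyFun E :=
  mem_polyFun.2 ⟨MvPolynomial.rename f.coord g, fun c => by
    rw [MvPolynomial.eval_rename]
    rfl⟩

theorem exists_eval_repr_ne_zero {n : ℕ} (f : Module.Basis (Fin n) ℂ E)
    {g : MvPolynomial (Fin n) ℂ} (hg : g ≠ 0) : ∃ c, MvPolynomial.eval (f.repr c) g ≠ 0 := by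
  by_contra! h
  refine hg (MvPolynomial.funext fun u => ?_)
  rw [map_zero, ← h (f.equivFun.symm u)]
  congr 1
  exact congrArg _ (f.equivFun.apply_symm_apply u).symm

end PolyFun

/-! ### Generic values and the singular set -/

section Representations

variable {𝔤 V : Type*} [LieRing 𝔤] [LieAlgebra ℂ 𝔤] [AddCommGroup V] [Module ℂ V]
  {ρ : 𝔤 →ₗ⁅ℂ⁆ Module.End ℂ V}

theorem kHorRep_eq {K : ℕ} {G : V × V → ℂ} (hG : G ∈ polyFun (V × V)) (hG0 : ∃ z, G z ≠ 0)
    (hK : ∀ y c, G (y, c) ≠ 0 → kHor ρ y c = K) : kHorRep ρ = K := by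
  have : {k | ∃ W : Set (V × V), IsZariskiOpen W ∧ W.Nonempty ∧
      ∀ x a : V, (x, a) ∈ W → kHor ρ x a = k} = {K} := by
    ext k
    constructor
    · rintro ⟨W, hW, ⟨z, hz⟩, hWk⟩
      obtain ⟨H, hH, hHz, hHW⟩ := hW.exists_polyFun hz
      obtain ⟨z₀, hz₀⟩ := hG0
      obtain ⟨⟨y, c⟩, h1, h2⟩ := exists_ne_zero_of_polyFun hG hH hz₀ hHz
      exact (hWk y c (hHW _ h2)).symm.trans (hK y c h1)
    · rintro rfl
      exact ⟨_, isZariskiOpen_of_polyFun hG, hG0, hK⟩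
  rw [kHorRep, this, csInf_singleton]

variable [FiniteDimensional ℂ 𝔤] {m n : ℕ} {e : Module.Basis (Fin m) ℂ 𝔤}
  {f : Module.Basis (Fin n) ℂ V}

/-- The degree criterion transfers the good behaviour of one pair (x, c) of the same type to (x, a),
since J depends only on the type. -/
theorem IsRegular.notMem_Sing₁_of_isGenericPair {x a : V} (hx : IsRegular ρ x)
    (hgen : IsGenericPair ρ x a) (t : ℂ) : a + t • x ∉ Sing₁ ρ e f := by
  rintro ⟨p, ⟨hp1, hp2⟩, hzero⟩
  choose h hh using hp1
  obtain ⟨W, hW, hmem, htype⟩ := hgen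
  obtain ⟨G, hG, hG0, hGW⟩ := hW.exists_polyFun hmem
  obtain ⟨s₀, t₀, hm0, -⟩ := hx.exists_natDegree_linePoly_minor e f 0
  have hp0 : p ≠ 0 := by
    rintro rfl
    exact hm0 (by rw [hh, zero_mul, map_zero])
  have hcop : ∀ d, (∀ st : (Fin (regRank ρ) ↪o Fin n) × (Fin (regRank ρ) ↪o Fin m),
      d ∣ h st.1 st.2) → IsUnit d := by
    intro d hd
    obtain ⟨k, hk⟩ := hp2 (p * d) fun s t => hh s t ▸ mul_dvd_mul_left p (hd (s, t))
    refine isUnit_of_dvd_one ⟨k, mul_left_cancel₀ hp0 ?_⟩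
    rw [mul_one, ← mul_assoc, ← hk]
  obtain ⟨g, hg0, hg⟩ := exists_generic_line hcop (f.repr x)
  obtain ⟨c₁, hc₁⟩ := exists_eval_repr_ne_zero f hg0
  -- Only the second point is moved: (x, c) stays in the open set of constant type, and the line c +
  -- tx avoids the common zeros of the h_i.
  obtain ⟨c, hGc, hgc⟩ := exists_ne_zero_of_polyFun (polyFun_prodMk hG x)
    (eval_repr_mem_polyFun f g) hG0 hc₁
  obtain ⟨N, b, σ, hb, hb'⟩ := htype x c (hGW _ hGc)
  have h1 := (hx.totalDegree_le_sum_jordanSize hb' hh).2.2 fun z => by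
    obtain ⟨st, hst⟩ := hg _ hgc z
    refine ⟨st.1, st.2, ?_⟩
    rw [map_add, map_smul]
    exact hst
  simp only [Block.jordanSize_relabel] at h1
  obtain ⟨s, t', hst⟩ := (hx.totalDegree_le_sum_jordanSize hb hh).2.1 h1 t
  -- `Sing₁` involves only minors that do not vanish identically; a zero minor has h = 0 because p ≠
  -- 0, contrary to `hst`.
  refine hst (hzero s t' (fun h0 => hst ?_) _ (hh s t'))
  rw [hh, mul_eq_zero] at h0
  rw [h0.resolve_left hp0, map_zero]

variable [FiniteDimensional ℂ V]

theorem IsRegular.finrank_stabiliserSum {x : V} (hx : IsRegular ρ x) (a : V) :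
    Module.finrank ℂ (stabiliserSum ρ x a) = kHor ρ x a :=
  (RegularPoint.kHorPencil_eq (F := linearFamily ρ) hx a).symm

theorem IsRegular.kHor_eq_kHorRep_of_sum_jordanSize_le {x a : V} (hx : IsRegular ρ x) {N : ℕ}
    {b : Fin N → Block} (hb : HasCanonicalForm (R ρ x) (R ρ a) b)
    (hle : ∀ y c : V, IsRegular ρ y → ∀ (N' : ℕ) (b' : Fin N' → Block),
      HasCanonicalForm (R ρ y) (R ρ c) b' → ∑ i, (b i).jordanSize ≤ ∑ i, (b' i).jordanSize) :
    kHor ρ x a = kHorRep ρ := by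
  obtain ⟨K, ⟨G, hG, hG0, hGK⟩, hK⟩ := exists_generic_kerSum (linearFamily ρ)
  obtain ⟨K', ⟨G', hG', hG0', hGK'⟩, hK'⟩ := exists_generic_kerSum (dualFamily (linearFamily ρ))
  rw [kHorRep_eq hG hG0 fun y c hyc => ((IsRegular.finrank_stabiliserSum
    (hGK y c hyc).1 c).symm.trans (hGK y c hyc).2)]
  obtain ⟨z, hz⟩ := hG0
  obtain ⟨z', hz'⟩ := hG0'
  -- At a pair generic for both families K + K' + J' = dim V + dim St_y. The same count at (x, a),
  -- with equal stabiliser dimensions and J ≤ J', gives k_hor + k_vert ≥ K + K'; as k_hor ≤ K and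
  -- k_vert ≤ K', both are equalities.
  obtain ⟨⟨y, c⟩, h1, h2⟩ := exists_ne_zero_of_polyFun hG hG' hz hz'
  obtain ⟨hy, hyK⟩ := hGK y c h1
  obtain ⟨-, hyK'⟩ := hGK' y c h2
  obtain ⟨N', b', hb'⟩ := exists_hasCanonicalForm (R ρ y) (R ρ c)
  have e1 := RegularPoint.finrank_kerSum_add (F := linearFamily ρ) hx (hasCanonicalForm_iff.1 hb)
  have e2 := RegularPoint.finrank_kerSum_add (F := linearFamily ρ) hy (hasCanonicalForm_iff.1 hb')
  have e3 := hK x a hx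
  have e4 := hK' x a (regularPoint_dualFamily_iff.2 hx)
  have e5 := hle y c hy N' b' hb'
  have e6 := hx y
  have e7 := hy x
  have e8 := hx.finrank_stabiliserSum a
  rw [stabiliserSum_eq_kerSum] at e8
  change Module.finrank ℂ (LinearMap.ker (linearFamily ρ x)) ≤
    Module.finrank ℂ (LinearMap.ker (linearFamily ρ y)) at e6
  omega

theorem IsRegular.kHor_eq_kHorRep_of_notMem_Sing₁ {x a : V} (hx : IsRegular ρ x)
    (hs : ∀ t : ℂ, a + t • x ∉ Sing₁ ρ e f) : kHor ρ x a = kHorRep ρ := by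
  obtain ⟨p, hp1, hp2⟩ := exists_gcd_family fun st :
    (Fin (regRank ρ) ↪o Fin n) × (Fin (regRank ρ) ↪o Fin m) => minor ρ e f st.1 st.2
  choose h hh using fun s t => hp1 (s, t)
  obtain ⟨N, b, hb⟩ := exists_hasCanonicalForm (R ρ x) (R ρ a)
  have hsize : ∑ i, (b i).jordanSize = p.totalDegree := by
    refine (hx.totalDegree_le_sum_jordanSize hb hh).2.2 fun z => ?_
    by_contra! hall
    refine hs z ⟨p, ⟨fun s t => hp1 (s, t), fun d hd => hp2 d fun st => hd _ _⟩,
      fun s t h0 h' hh' => ?_⟩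
    have hp0 : p ≠ 0 := by
      rintro rfl
      exact h0 (by rw [hh', zero_mul])
    rw [← mul_left_cancel₀ hp0 ((hh s t).symm.trans hh')]
    exact hall s t
  refine hx.kHor_eq_kHorRep_of_sum_jordanSize_le hb fun y c hy N' b' hb' => ?_
  rw [hsize]
  exact (hy.totalDegree_le_sum_jordanSize hb' hh).1

end Representations

end JK

theorem mainTheorem11 {𝔤 V : Type*} [LieRing 𝔤] [LieAlgebra ℂ 𝔤] [FiniteDimensional ℂ 𝔤]
    [AddCommGroup V] [Module ℂ V] [FiniteDimensional ℂ V]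
    (ρ : 𝔤 →ₗ⁅ℂ⁆ Module.End ℂ V)
    {m n : ℕ} (e : Module.Basis (Fin m) ℂ 𝔤) (f : Module.Basis (Fin n) ℂ V)
    (x a : V) (hx : JK.IsRegular ρ x) :
    Module.finrank ℂ (JK.stabiliserSum ρ x a) = JK.kHor ρ x a ∧
    ((∀ t : ℂ, a + t • x ∉ JK.Sing₁ ρ e f) →
      Module.finrank ℂ (JK.stabiliserSum ρ x a) = JK.kHorRep ρ) ∧
    (JK.IsGenericPair ρ x a →
      (∀ t : ℂ, a + t • x ∉ JK.Sing₁ ρ e f) ∧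
      Module.finrank ℂ (JK.stabiliserSum ρ x a) = JK.kHorRep ρ) := by
  rw [hx.finrank_stabiliserSum a]
  refine ⟨rfl, fun hs => hx.kHor_eq_kHorRep_of_notMem_Sing₁ hs, fun hgen => ?_⟩
  have hs := fun t => hx.notMem_Sing₁_of_isGenericPair (e := e) (f := f) hgen t
  exact ⟨hs, hx.kHor_eq_kHorRep_of_notMem_Sing₁ hs⟩
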